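/- Let $\mathbf k$ be a field in which $2\neq 0$. **Networks.** A *perfect planar network* is a finite directed graph $\Gamma$ embedded in an oriented disk such that the vertices on the boundary are univalent, the internal vertices are trivalent, and no internal vertex is a source or a sink. An internal vertex is *white* if it has a unique incoming edge and *black* if it has a unique outgoing edge. Assume that $\Gamma$ is acyclic (it has no oriented cycles) and has $m$ sources and $n$ sinks, all on the boundary, and that the sources and the sinks are *separated*: going clockwise along the boundary one meets first the sinks, numbered $1,\dots,n$ in this order, and then the sources, in the order $m,m-1,\dots,1$. **Double bracket.** Let $\mathcal C$ be the $\mathbf k$-linear category of paths in $\Gamma$: its objects are the vertices, $\mathrm{Hom}(a,b)$ is the vector space spanned by the paths from $a$ to $b$, and $fg$ denotes the concatenation of $f$ followed by $g$. For a tensor $f\otimes g$ put $(f\otimes g)^\tau=g\otimes f$, and multiply tensors by $(f\otimes g)(h\otimes l)=fh\otimes gl$. A double bracket on $\mathcal C$ is a family of linear maps $\{\!\!\{-,-\}\!\!\}:\mathrm{Hom}(a,b)\otimes\mathrm{Hom}(c,d)\to\mathrm{Hom}(c,b)\otimes\mathrm{Hom}(a,d)$ with $\{\!\!\{f,g\}\!\!\}=-\{\!\!\{g,f\}\!\!\}^\tau$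 and $$\{\!\!\{fg,h\}\!\!\}=(\mathbf 1_{s(h)}\otimes f)\{\!\!\{g,h\}\!\!\}+\{\!\!\{f,h\}\!\!\}(g\otimes\mathbf 1_{t(h)}),\qquad \{\!\!\{f,gh\}\!\!\}=(g\otimes\mathbf 1_{s(f)})\{\!\!\{f,h\}\!\!\}+\{\!\!\{f,g\}\!\!\}(\mathbf 1_{t(f)}\otimes h),$$ where $s$ and $t$ denote the source and the target. It is determined by its values on pairs of edges. Let $w_{12},w_{13},w_{23},b_{12},b_{13},b_{23}\in\mathbf k$ satisfy $$w_{12}+w_{13}-w_{23}=\tfrac12,\qquad b_{12}+b_{13}-b_{23}=-\tfrac12 ,$$ and let the bracket of two edges be the sum of the following contributions (completed by skew-symmetry) of the internal vertices $V$. If $V$ is white and $x_1,x_2,x_3$ are the edges at $V$ in counterclockwise order, $x_3$ being the incoming one, then $V$ contributes $$\{\!\!\{x_1,x_2\}\!\!\}=w_{12}\,x_1\otimes x_2,\quad \{\!\!\{x_1,x_3\}\!\!\}=w_{13}\,x_3x_1\otimes\mathbf 1_V,\quad \{\!\!\{x_2,x_3\}\!\!\}=w_{23}\,x_3x_2\otimes\mathbf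 1_V ;$$ if $V$ is black and $y_1,y_2,y_3$ are the edges at $V$ in counterclockwise order, $y_3$ being the outgoing one, then $V$ contributes $$\{\!\!\{y_1,y_2\}\!\!\}=b_{12}\,y_2\otimes y_1,\quad \{\!\!\{y_1,y_3\}\!\!\}=b_{13}\,\mathbf 1_V\otimes y_1y_3,\quad \{\!\!\{y_2,y_3\}\!\!\}=b_{23}\,\mathbf 1_V\otimes y_2y_3 .$$ (This is the double bracket of the twisted ribbon graph of $\Gamma$, for instance with $w_{12}=\frac12$, $b_{12}=-\frac12$ and all other coefficients $0$, or with $(w_{12},w_{13},w_{23})=(\frac12,-\frac12,-\frac12)$ and $(b_{12},b_{13},b_{23})=(-\frac12,\frac12,\frac12)$.) **Matrices.** The *boundary measurement matrix* $B=B_\Gamma$ is the $m\times n$ matrix over $\mathcal C$ whose entry $b_{ij}$ is the sum of all paths from source $i$ to sink $j$. Let $B_L$ and $B_R$ be the matrices with entries $b_{ij}\otimes 1$ and $1\otimes b_{ij}$, let $\boxtimes$ be the Kronecker product of matrices, let $\tau$ act on matrices over $\mathcal C\otimes\mathcal C$ entry by entry, put $\{\!\!\{B,B\}\!\!\}=\sum_{i,j,k,l}\{\!\!\{b_{ij},b_{kl}\}\!\!\}\,E_{ij}\boxtimes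 E_{kl}$, and for $N\ge 0$ let $$r_N=\frac12\sum_{1\le i<j\le N}\left(E_{ji}\boxtimes E_{ij}-E_{ij}\boxtimes E_{ji}\right).$$ **Theorem.** For every such network, $$\{\!\!\{B,B\}\!\!\}=r_m\,(B_L\boxtimes B_R)-\Big((B_L\boxtimes B_R)\,r_n\Big)^{\tau}.$$ In particular, if $B$ is square ($m=n$), then $\{\!\!\{B,B\}\!\!\}=[r_n,\,B_L\boxtimes B_R]_\tau$, where $[X,Y]_\tau=XY-(YX)^\tau$. -/

import Mathlib

open scoped TensorProduct Kronecker

noncomputable section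

/-! ## The path algebra of a quiver

The `k`-linear category generated by the arrows of a quiver, regarded as an algebra with many
objects: its elements are formal linear combinations of paths, and the product is concatenation,
written in the order of travel (and `0` for paths that do not compose). -/

/-- All paths of a quiver, with their source and target. -/
abbrev PathIndex (Q : Type*) [Quiver Q] := Σ a b : Q, Quiver.Path a b

/-- Formal `k`-linear combinations of paths. -/
def PathAlgebra (k : Type*) (Q : Type*) [CommRing k] [Quiver Q] := PathIndex Q →₀ k

namespace PathAlgebra

section Basic

variable (k : Type*) {Q : Type*} [CommRing k] [Quiver Q]

instance (priority := low) : AddCommGroup (PathAlgebra k Q) := inferInstanceAs (AddCommGroup (PathIndex Q →₀ k))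

instance (priority := low) : Module k (PathAlgebra k Q) := inferInstanceAs (Module k (PathIndex Q →₀ k))

/-- A path, as an element of the path algebra. -/
def ofPath {a b : Q} (p : Quiver.Path a b) : PathAlgebra k Q :=
  Finsupp.single (⟨a, b, p⟩ : PathIndex Q) (1 : k)

/-- The identity morphism of the object `a`, that is, the constant path at `a`. -/
def idem (a : Q) : PathAlgebra k Q := ofPath k (Quiver.Path.nil : Quiver.Path a a)

/-- The linear map with prescribed values on paths. -/
def lift {M : Type*} [AddCommGroup M] [Module k M] (φ : PathIndex Q → M) :
    PathAlgebra k Q →ₗ[k] M :=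
  Finsupp.linearCombination k φ

theorem lift_ofPath {M : Type*} [AddCommGroup M] [Module k M] (φ : PathIndex Q → M)
    {a b : Q} (p : Quiver.Path a b) : lift k φ (ofPath k p) = φ ⟨a, b, p⟩ :=
  (Finsupp.linearCombination_single k (1 : k) (⟨a, b, p⟩ : PathIndex Q)).trans (one_smul k _)

theorem induction {P : PathAlgebra k Q → Prop} (x : PathAlgebra k Q) (zero : P 0)
    (add : ∀ x y, P x → P y → P (x + y)) (smul : ∀ (r : k) x, P x → P (r • x))
    (path : ∀ {a b : Q} (p : Quiver.Path a b), P (ofPath k p)) : P x := by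
  refine Finsupp.induction_linear (motive := P) x zero add fun i r => ?_
  have h : (Finsupp.single i r : PathIndex Q →₀ k) = r • Finsupp.single i 1 := by
    rw [Finsupp.smul_single, smul_eq_mul, mul_one]
  have h' := smul r _ (path i.2.2)
  exact h ▸ h'

open Classical in
/-- Concatenation of two paths: `0` if they are not composable. -/
def concat (x y : PathIndex Q) : PathAlgebra k Q :=
  if h : y.1 = x.2.1 then ofPath k (x.2.2.comp (y.2.2.cast h rfl)) else 0

/-- The product of the path algebra, as a bilinear map. -/
def mulMap : PathAlgebra k Q →ₗ[k] PathAlgebra k Q →ₗ[k] PathAlgebra k Q :=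
  lift k fun x => lift k fun y => concat k x y

theorem mulMap_comp {a b c : Q} (p : Quiver.Path a b) (q : Quiver.Path b c) :
    mulMap k (ofPath k p) (ofPath k q) = ofPath k (p.comp q) := by
  simp [mulMap, lift_ofPath, concat]

theorem mulMap_of_ne {a b c d : Q} (p : Quiver.Path a b) (q : Quiver.Path c d) (h : c ≠ b) :
    mulMap k (ofPath k p) (ofPath k q) = 0 := by
  simp [mulMap, lift_ofPath, concat, h]

theorem mulMap_assoc (x y z : PathAlgebra k Q) :
    mulMap k (mulMap k x y) z = mulMap k x (mulMap k y z) := by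
  induction x using PathAlgebra.induction with
  | zero => simp
  | add x x' hx hx' => simp [hx, hx']
  | smul r x hx => simp [hx]
  | @path a b p =>
  induction y using PathAlgebra.induction with
  | zero => simp
  | add x x' hx hx' => simp [hx, hx']
  | smul r x hx => simp [hx]
  | @path c d q =>
  induction z using PathAlgebra.induction with
  | zero => simp
  | add x x' hx hx' => simp [hx, hx']
  | smul r x hx => simp [hx]
  | @path e f r =>
  by_cases h : c = b
  · subst h
    by_cases h' : e = d
    · subst h'
      simp [mulMap_comp, Quiver.Path.comp_assoc]
    · simp [mulMap_comp, mulMap_of_ne k _ _ h']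
  · by_cases h' : e = d
    · subst h'
      simp [mulMap_comp, mulMap_of_ne k _ _ h]
    · simp [mulMap_of_ne k _ _ h, mulMap_of_ne k _ _ h']

instance : Mul (PathAlgebra k Q) := ⟨fun x y => mulMap k x y⟩

instance [Fintype Q] : One (PathAlgebra k Q) := ⟨∑ a : Q, idem k a⟩

theorem mul_def (x y : PathAlgebra k Q) : x * y = mulMap k x y := rfl

theorem one_def [Fintype Q] : (1 : PathAlgebra k Q) = ∑ a : Q, idem k a := rfl

theorem ofPath_mul_ofPath {a b c : Q} (p : Quiver.Path a b) (q : Quiver.Path b c) :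
    ofPath k p * ofPath k q = ofPath k (p.comp q) := mulMap_comp k p q

theorem ofPath_mul_ofPath_of_ne {a b c d : Q} (p : Quiver.Path a b) (q : Quiver.Path c d)
    (h : c ≠ b) : ofPath k p * ofPath k q = 0 := mulMap_of_ne k p q h

theorem idem_mul_ofPath {a b : Q} (p : Quiver.Path a b) : idem k a * ofPath k p = ofPath k p := by
  rw [idem, ofPath_mul_ofPath, Quiver.Path.nil_comp]

theorem ofPath_mul_idem {a b : Q} (p : Quiver.Path a b) : ofPath k p * idem k b = ofPath k p := by
  rw [idem, ofPath_mul_ofPath, Quiver.Path.comp_nil]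

theorem idem_mul_idem (a : Q) : idem k a * idem k a = idem k a := idem_mul_ofPath k _

theorem ofPath_cons {a b c : Q} (p : Quiver.Path a b) (e : b ⟶ c) :
    ofPath k (p.cons e) = ofPath k p * ofPath k e.toPath := by
  rw [ofPath_mul_ofPath]; rfl

instance [Fintype Q] : Ring (PathAlgebra k Q) :=
  { (inferInstance : AddCommGroup (PathAlgebra k Q)) with
    mul := (· * ·)
    one := 1
    left_distrib := fun x y z => by simp [mul_def]
    right_distrib := fun x y z => by simp [mul_def]
    zero_mul := fun x => by simp [mul_def]
    mul_zero := fun x => by simp [mul_def]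
    mul_assoc := fun x y z => mulMap_assoc k x y z
    one_mul := fun x => by
      rw [mul_def]
      induction x using PathAlgebra.induction with
      | zero => simp
      | add x x' hx hx' => rw [map_add, hx, hx']
      | smul r x hx => rw [map_smul, hx]
      | @path a b p =>
        rw [one_def, map_sum, LinearMap.sum_apply, Finset.sum_eq_single a]
        · exact idem_mul_ofPath k p
        · intro c _ hc
          exact mulMap_of_ne k _ _ hc.symm
        · simp
    mul_one := fun x => by
      rw [mul_def]
      induction x using PathAlgebra.induction with
      | zero => simp
      | add x x' hx hx' => rw [map_add, LinearMap.add_apply, hx, hx']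
      | smul r x hx => rw [map_smul, LinearMap.smul_apply, hx]
      | @path a b p =>
        rw [one_def, map_sum, Finset.sum_eq_single b]
        · exact ofPath_mul_idem k p
        · intro c _ hc
          exact mulMap_of_ne k _ _ hc
        · simp }

instance [Fintype Q] : Algebra k (PathAlgebra k Q) :=
  Algebra.ofModule (fun r x y => by simp [mul_def]) (fun r x y => by simp [mul_def])

end Basic

end PathAlgebra

/-! ## Double brackets -/

section DoubleBracket

variable (k : Type*) (Q : Type*) [CommRing k] [Quiver Q] [Fintype Q]

/-- The transposition `τ` of the two tensor factors. -/
def tensorSwap : PathAlgebra k Q ⊗[k] PathAlgebra k Q →ₗ[k] PathAlgebra k Q ⊗[k] PathAlgebra k Q :=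
  (TensorProduct.comm k (PathAlgebra k Q) (PathAlgebra k Q)).toLinearMap

/-- A double bracket on the linear category of paths of a quiver: a skew-symmetric bilinear
operation `Hom(a,b) ⊗ Hom(c,d) → Hom(c,b) ⊗ Hom(a,d)` subject to both double Leibniz identities. -/
structure DoubleBracket where
  /-- The underlying bilinear map. -/
  bracket : PathAlgebra k Q →ₗ[k] PathAlgebra k Q →ₗ[k] PathAlgebra k Q ⊗[k] PathAlgebra k Q
  source_target : ∀ {a b c d : Q} (f : Quiver.Path a b) (g : Quiver.Path c d),
    (PathAlgebra.idem k c ⊗ₜ[k] PathAlgebra.idem k a) *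
        bracket (PathAlgebra.ofPath k f) (PathAlgebra.ofPath k g) *
        (PathAlgebra.idem k b ⊗ₜ[k] PathAlgebra.idem k d) =
      bracket (PathAlgebra.ofPath k f) (PathAlgebra.ofPath k g)
  skew : ∀ f g, bracket f g = -tensorSwap k Q (bracket g f)
  leibniz_left : ∀ {a b c s t : Q} (f : Quiver.Path a b) (g : Quiver.Path b c)
      (h : Quiver.Path s t),
    bracket (PathAlgebra.ofPath k f * PathAlgebra.ofPath k g) (PathAlgebra.ofPath k h) =
      (PathAlgebra.idem k s ⊗ₜ[k] PathAlgebra.ofPath k f) *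
          bracket (PathAlgebra.ofPath k g) (PathAlgebra.ofPath k h) +
        bracket (PathAlgebra.ofPath k f) (PathAlgebra.ofPath k h) *
          (PathAlgebra.ofPath k g ⊗ₜ[k] PathAlgebra.idem k t)
  leibniz_right : ∀ {s t a b c : Q} (f : Quiver.Path s t) (g : Quiver.Path a b)
      (h : Quiver.Path b c),
    bracket (PathAlgebra.ofPath k f) (PathAlgebra.ofPath k g * PathAlgebra.ofPath k h) =
      (PathAlgebra.ofPath k g ⊗ₜ[k] PathAlgebra.idem k s) *
          bracket (PathAlgebra.ofPath k f) (PathAlgebra.ofPath k h) +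
        bracket (PathAlgebra.ofPath k f) (PathAlgebra.ofPath k g) *
          (PathAlgebra.idem k t ⊗ₜ[k] PathAlgebra.ofPath k h)

/-- Skew-symmetric values of a double bracket on pairs of arrows, with the sources and targets
that a double bracket requires. -/
structure ArrowBracket where
  /-- The value on a pair of arrows. -/
  val : ∀ {a b c d : Q}, (a ⟶ b) → (c ⟶ d) → PathAlgebra k Q ⊗[k] PathAlgebra k Q
  source : ∀ {a b c d : Q} (e : a ⟶ b) (f : c ⟶ d),
    (PathAlgebra.idem k c ⊗ₜ[k] PathAlgebra.idem k a) * val e f = val e f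
  target : ∀ {a b c d : Q} (e : a ⟶ b) (f : c ⟶ d),
    val e f * (PathAlgebra.idem k b ⊗ₜ[k] PathAlgebra.idem k d) = val e f
  skew : ∀ {a b c d : Q} (e : a ⟶ b) (f : c ⟶ d), val e f = -tensorSwap k Q (val f e)

namespace ArrowBracket

variable {k Q}

/-- The double bracket of an arrow and a path, computed by the second Leibniz identity from the
values on pairs of arrows. -/
def extendRight (L : ArrowBracket k Q) {a b c : Q} (e : a ⟶ b) :
    ∀ {d : Q}, Quiver.Path c d → PathAlgebra k Q ⊗[k] PathAlgebra k Q
  | _, Quiver.Path.nil => 0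
  | _, Quiver.Path.cons q f =>
      (PathAlgebra.ofPath k q ⊗ₜ[k] PathAlgebra.idem k a) * L.val e f +
        L.extendRight e q * (PathAlgebra.idem k b ⊗ₜ[k] PathAlgebra.ofPath k f.toPath)

/-- The double bracket of two paths, computed by the first Leibniz identity from the brackets of
an arrow and a path. -/
def extend (L : ArrowBracket k Q) {a c d : Q} :
    ∀ {b : Q}, Quiver.Path a b → Quiver.Path c d → PathAlgebra k Q ⊗[k] PathAlgebra k Q
  | _, Quiver.Path.nil, _ => 0
  | _, Quiver.Path.cons p e, q =>
      (PathAlgebra.idem k c ⊗ₜ[k] PathAlgebra.ofPath k p) * L.extendRight e q +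
        L.extend p q * (PathAlgebra.ofPath k e.toPath ⊗ₜ[k] PathAlgebra.idem k d)

theorem swap_mul (x y : PathAlgebra k Q ⊗[k] PathAlgebra k Q) :
    tensorSwap k Q (x * y) = tensorSwap k Q x * tensorSwap k Q y :=
  map_mul (Algebra.TensorProduct.comm k (PathAlgebra k Q) (PathAlgebra k Q)) x y

theorem swap_tmul (x y : PathAlgebra k Q) : tensorSwap k Q (x ⊗ₜ[k] y) = y ⊗ₜ[k] x := rfl

theorem extendRight_source (L : ArrowBracket k Q) {a b c d : Q} (e : a ⟶ b)
    (q : Quiver.Path c d) :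
    (PathAlgebra.idem k c ⊗ₜ[k] PathAlgebra.idem k a) * L.extendRight e q =
      L.extendRight e q := by
  induction q with
  | nil => simp [extendRight]
  | cons q f ih =>
    rw [extendRight, mul_add, ← mul_assoc, ← mul_assoc, ih,
      Algebra.TensorProduct.tmul_mul_tmul, PathAlgebra.idem_mul_ofPath, PathAlgebra.idem_mul_idem]

theorem extendRight_target (L : ArrowBracket k Q) {a b c d : Q} (e : a ⟶ b)
    (q : Quiver.Path c d) :
    L.extendRight e q * (PathAlgebra.idem k b ⊗ₜ[k] PathAlgebra.idem k d) =
      L.extendRight e q := by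
  cases q with
  | nil => simp [extendRight]
  | cons q f =>
    rw [extendRight, add_mul, mul_assoc, mul_assoc, L.target,
      Algebra.TensorProduct.tmul_mul_tmul, PathAlgebra.ofPath_mul_idem, PathAlgebra.idem_mul_idem]

theorem extend_source (L : ArrowBracket k Q) {a b c d : Q} (p : Quiver.Path a b)
    (q : Quiver.Path c d) :
    (PathAlgebra.idem k c ⊗ₜ[k] PathAlgebra.idem k a) * L.extend p q = L.extend p q := by
  induction p with
  | nil => simp [extend]
  | cons p e ih =>
    rw [extend, mul_add, ← mul_assoc, ← mul_assoc, ih,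
      Algebra.TensorProduct.tmul_mul_tmul, PathAlgebra.idem_mul_ofPath, PathAlgebra.idem_mul_idem]

theorem extend_target (L : ArrowBracket k Q) {a b c d : Q} (p : Quiver.Path a b)
    (q : Quiver.Path c d) :
    L.extend p q * (PathAlgebra.idem k b ⊗ₜ[k] PathAlgebra.idem k d) = L.extend p q := by
  cases p with
  | nil => simp [extend]
  | cons p e =>
    rw [extend, add_mul, mul_assoc, mul_assoc, extendRight_target,
      Algebra.TensorProduct.tmul_mul_tmul, PathAlgebra.ofPath_mul_idem, PathAlgebra.idem_mul_idem]

theorem extend_toPath_cons (L : ArrowBracket k Q) {a b c d s : Q} (f : c ⟶ d)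
    (q : Quiver.Path s a) (e : a ⟶ b) :
    L.extend (q.cons e) f.toPath =
      (PathAlgebra.idem k c ⊗ₜ[k] PathAlgebra.ofPath k q) * L.val e f +
        L.extend q f.toPath * (PathAlgebra.ofPath k e.toPath ⊗ₜ[k] PathAlgebra.idem k d) := by
  rw [extend]
  congr 2
  change (PathAlgebra.idem k c ⊗ₜ[k] PathAlgebra.idem k a) * L.val e f + 0 * _ = _
  rw [L.source, zero_mul, add_zero]

theorem extendRight_eq_neg_swap (L : ArrowBracket k Q) {a b c d : Q} (e : a ⟶ b)
    (q : Quiver.Path c d) :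
    L.extendRight e q = -tensorSwap k Q (L.extend q e.toPath) := by
  induction q with
  | nil => simp [extendRight, extend]
  | cons q f ih =>
    rw [extend_toPath_cons, extendRight, ih, L.skew e f, map_add, swap_mul, swap_mul, swap_tmul,
      swap_tmul]
    simp only [mul_neg, neg_mul, neg_add]

theorem extendRight_comp (L : ArrowBracket k Q) {a b c d s : Q} (e : a ⟶ b)
    (q : Quiver.Path c d) (r : Quiver.Path d s) :
    L.extendRight e (q.comp r) =
      (PathAlgebra.ofPath k q ⊗ₜ[k] PathAlgebra.idem k a) * L.extendRight e r +
        L.extendRight e q * (PathAlgebra.idem k b ⊗ₜ[k] PathAlgebra.ofPath k r) := by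
  induction r with
  | nil =>
    have h := L.extendRight_target e q
    simp only [extendRight, Quiver.Path.comp_nil, mul_zero, zero_add]
    exact h.symm
  | cons r f ih =>
    rw [Quiver.Path.comp_cons, extendRight, ih, extendRight, add_mul, mul_add, PathAlgebra.ofPath_cons,
      mul_assoc (L.extendRight e q), Algebra.TensorProduct.tmul_mul_tmul, PathAlgebra.idem_mul_idem,
      ← PathAlgebra.ofPath_mul_ofPath, ← mul_assoc, ← mul_assoc,
      Algebra.TensorProduct.tmul_mul_tmul, PathAlgebra.idem_mul_idem, add_assoc]

theorem extend_comp_left (L : ArrowBracket k Q) {a b c s t : Q} (f : Quiver.Path a b)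
    (g : Quiver.Path b c) (h : Quiver.Path s t) :
    L.extend (f.comp g) h =
      (PathAlgebra.idem k s ⊗ₜ[k] PathAlgebra.ofPath k f) * L.extend g h +
        L.extend f h * (PathAlgebra.ofPath k g ⊗ₜ[k] PathAlgebra.idem k t) := by
  induction g with
  | nil =>
    have h' := L.extend_target f h
    simp only [extend, Quiver.Path.comp_nil, mul_zero, zero_add]
    exact h'.symm
  | cons g e ih =>
    rw [Quiver.Path.comp_cons, extend, ih, extend, add_mul, mul_add, PathAlgebra.ofPath_cons,
      mul_assoc (L.extend f h), Algebra.TensorProduct.tmul_mul_tmul, PathAlgebra.idem_mul_idem,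
      ← PathAlgebra.ofPath_mul_ofPath, ← mul_assoc, ← mul_assoc,
      Algebra.TensorProduct.tmul_mul_tmul, PathAlgebra.idem_mul_idem, add_assoc]

theorem extend_comp_right (L : ArrowBracket k Q) {a b c s t : Q} (f : Quiver.Path s t)
    (g : Quiver.Path a b) (h : Quiver.Path b c) :
    L.extend f (g.comp h) =
      (PathAlgebra.ofPath k g ⊗ₜ[k] PathAlgebra.idem k s) * L.extend f h +
        L.extend f g * (PathAlgebra.idem k t ⊗ₜ[k] PathAlgebra.ofPath k h) := by
  induction f with
  | nil => simp [extend]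
  | @cons u t f e ih =>
    rw [extend, extend, extend, extendRight_comp, ih]
    simp only [mul_add, add_mul, ← mul_assoc, Algebra.TensorProduct.tmul_mul_tmul,
      PathAlgebra.idem_mul_ofPath, PathAlgebra.ofPath_mul_idem]
    simp only [mul_assoc, Algebra.TensorProduct.tmul_mul_tmul, PathAlgebra.idem_mul_ofPath,
      PathAlgebra.ofPath_mul_idem]
    abel

theorem extend_skew (L : ArrowBracket k Q) {a b c d : Q} (p : Quiver.Path a b)
    (q : Quiver.Path c d) : L.extend p q = -tensorSwap k Q (L.extend q p) := by
  induction p with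
  | nil =>
    have h : ∀ {t : Q} (r : Quiver.Path c t),
        L.extend r (Quiver.Path.nil : Quiver.Path a a) = 0 := by
      intro t r
      induction r with
      | nil => rfl
      | cons r e ih => simp [extend, extendRight, ih]
    rw [h]; simp [extend]
  | cons p e ih =>
    have h := L.extend_comp_right q p e.toPath
    change L.extend q (p.cons e) = _ at h
    rw [h, extend, ih, extendRight_eq_neg_swap, map_add, swap_mul, swap_mul, swap_tmul, swap_tmul]
    simp only [mul_neg, neg_mul, neg_add]

/-- The double bracket with the given values on arrows: values on paths are computed by the
double Leibniz identities, and extended bilinearly. -/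
def toDoubleBracket (L : ArrowBracket k Q) : DoubleBracket k Q where
  bracket := PathAlgebra.lift k fun x => PathAlgebra.lift k fun y => L.extend x.2.2 y.2.2
  source_target f g := by
    simp only [PathAlgebra.lift_ofPath, extend_source, extend_target]
  skew f g := by
    induction f using PathAlgebra.induction with
    | zero => simp
    | add x x' hx hx' => simp only [map_add, LinearMap.add_apply, hx, hx', neg_add]
    | smul r x hx => simp only [map_smul, LinearMap.smul_apply, hx, smul_neg]
    | path p =>
    induction g using PathAlgebra.induction with
    | zero => simp
    | add x x' hx hx' => simp only [map_add, LinearMap.add_apply, hx, hx', neg_add]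
    | smul r x hx => simp only [map_smul, LinearMap.smul_apply, hx, smul_neg]
    | path q =>
      simp only [PathAlgebra.lift_ofPath]
      exact L.extend_skew p q
  leibniz_left f g h := by
    simp only [PathAlgebra.ofPath_mul_ofPath, PathAlgebra.lift_ofPath, extend_comp_left]
  leibniz_right f g h := by
    simp only [PathAlgebra.ofPath_mul_ofPath, PathAlgebra.lift_ofPath, extend_comp_right]

theorem toDoubleBracket_arrow (L : ArrowBracket k Q) {a b c d : Q} (e : a ⟶ b) (f : c ⟶ d) :
    L.toDoubleBracket.bracket (PathAlgebra.ofPath k e.toPath) (PathAlgebra.ofPath k f.toPath) =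
      L.val e f := by
  simp only [toDoubleBracket, PathAlgebra.lift_ofPath]
  rw [Quiver.Hom.toPath, extend_toPath_cons]
  change (PathAlgebra.idem k c ⊗ₜ[k] PathAlgebra.idem k a) * L.val e f + 0 * _ = _
  rw [L.source, zero_mul, add_zero]

end ArrowBracket

end DoubleBracket

/-! ## Perfect planar networks -/

/-- The vertices of a network in a disk: `m` boundary sources, `n` boundary sinks, and the
internal vertices. -/
inductive NetworkVertex (m n : ℕ) (I : Type*)
  | source (i : Fin m)
  | sink (j : Fin n)
  | inner (v : I)

/-- The number of orbits of a permutation group. -/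
def orbitCount {D : Type*} (G : Subgroup (Equiv.Perm D)) : ℕ :=
  Nat.card (MulAction.orbitRel.Quotient G D)

/-- A perfect network embedded in an oriented disk, with `m` sources and `n` sinks separated from
each other on the boundary; `I` is the set of internal vertices and `E` the set of edges.

The edge `e` has two half-edges: `Sum.inl e` at its source and `Sum.inr e` at its target.
The embedding is recorded, up to orientation-preserving homeomorphism, by its rotation system.
Collapsing the boundary circle of the disk to one point turns the disk into a sphere, and the
network into a graph on that sphere whose vertices are the internal vertices and one further
vertex `∞`, the image of all boundary vertices. The permutation `rotation` sends each half-edge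
to the next one in counterclockwise order around its vertex on the sphere. Around `∞` this is the
clockwise order of the boundary vertices along the boundary of the disk, that is: sinks
`1, …, n`, then sources `m, …, 1`. (Sources and sinks are both numbered from top to bottom,
the sources lying on the left side of the disk and the sinks on the right side.) -/
structure PerfectPlanarNetwork (m n : ℕ) (I E : Type*) [Fintype I] [Fintype E] where
  /-- The source of an edge. -/
  src : E → NetworkVertex m n I
  /-- The target of an edge. -/
  tgt : E → NetworkVertex m n I
  /-- The only edge at a boundary source. -/
  sourceEdge : Fin m → E
  /-- The only edge at a boundary sink. -/
  sinkEdge : Fin n → E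
  src_eq_source : ∀ e i, src e = NetworkVertex.source i ↔ e = sourceEdge i
  tgt_ne_source : ∀ e i, tgt e ≠ NetworkVertex.source i
  tgt_eq_sink : ∀ e j, tgt e = NetworkVertex.sink j ↔ e = sinkEdge j
  src_ne_sink : ∀ e j, src e ≠ NetworkVertex.sink j
  /-- Internal vertices are trivalent. -/
  trivalent : ∀ v : I, Nat.card {h : E ⊕ E // Sum.elim src tgt h = NetworkVertex.inner v} = 3
  /-- Internal vertices are not sources. -/
  exists_incoming : ∀ v : I, ∃ e, tgt e = NetworkVertex.inner v
  /-- Internal vertices are not sinks. -/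
  exists_outgoing : ∀ v : I, ∃ e, src e = NetworkVertex.inner v
  /-- The next half-edge in counterclockwise order, around each vertex of the sphere. -/
  rotation : Equiv.Perm (E ⊕ E)
  rotation_inner : ∀ (v : I) (h : E ⊕ E), Sum.elim src tgt h = NetworkVertex.inner v →
    Sum.elim src tgt (rotation h) = NetworkVertex.inner v
  rotation_sameCycle : ∀ (v : I) (h h' : E ⊕ E), Sum.elim src tgt h = NetworkVertex.inner v →
    Sum.elim src tgt h' = NetworkVertex.inner v → rotation.SameCycle h h'
  rotation_boundary : ∀ i : Fin (n + m),
    rotation (Fin.append (fun j => Sum.inr (sinkEdge j))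
        (fun i => Sum.inl (sourceEdge (Fin.rev i))) i) =
      Fin.append (fun j => Sum.inr (sinkEdge j))
        (fun i => Sum.inl (sourceEdge (Fin.rev i))) (finRotate (n + m) i)
  /-- Planarity, that is, Euler's formula `V + F = E + 2 C` on the sphere. The vertices, edges,
  faces and connected components are the orbits on half-edges of the rotation, of the exchange of
  the two halves of each edge, of their composite, and of the group which they generate. -/
  planar :
    orbitCount (Subgroup.zpowers rotation) +
        orbitCount (Subgroup.zpowers (rotation * Equiv.sumComm E E)) =
      orbitCount (Subgroup.zpowers (Equiv.sumComm E E : Equiv.Perm (E ⊕ E))) +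
        2 * orbitCount (Subgroup.closure {rotation, (Equiv.sumComm E E : Equiv.Perm (E ⊕ E))})

/-- Six scalars: the coefficients of the local brackets at the white and at the black vertices. -/
structure LocalWeights (k : Type*) where
  (w₁₂ w₁₃ w₂₃ b₁₂ b₁₃ b₂₃ : k)

/-- The local weights of the surface of the twisted ribbon graph, in which the ribbons of edges
between vertices of different colours are half-twisted: the orientation is reversed at the black
vertices. -/
def LocalWeights.twistedRibbon (k : Type*) [Field k] : LocalWeights k where
  w₁₂ := 1 / 2
  w₁₃ := -(1 / 2)
  w₂₃ := -(1 / 2)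
  b₁₂ := -(1 / 2)
  b₁₃ := 1 / 2
  b₂₃ := 1 / 2

theorem LocalWeights.twistedRibbon_white (k : Type*) [Field k] :
    (twistedRibbon k).w₁₂ + (twistedRibbon k).w₁₃ - (twistedRibbon k).w₂₃ = 1 / 2 := by
  simp [twistedRibbon]

theorem LocalWeights.twistedRibbon_black (k : Type*) [Field k] :
    (twistedRibbon k).b₁₂ + (twistedRibbon k).b₁₃ - (twistedRibbon k).b₂₃ = -(1 / 2) := by
  simp [twistedRibbon]

namespace PerfectPlanarNetwork

section Network

variable {m n : ℕ} {I E : Type*} [Fintype I] [Fintype E]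

/-- The vertices of a network, as the objects of a quiver. -/
def Vertex (_N : PerfectPlanarNetwork m n I E) := NetworkVertex m n I

variable (N : PerfectPlanarNetwork m n I E)

/-- The arrows from `a` to `b` are the edges from `a` to `b`. -/
instance : Quiver N.Vertex := ⟨fun a b => {e : E // N.src e = a ∧ N.tgt e = b}⟩

instance : Fintype N.Vertex :=
  Fintype.ofEquiv (Fin m ⊕ Fin n ⊕ I)
    { toFun := Sum.elim NetworkVertex.source (Sum.elim NetworkVertex.sink NetworkVertex.inner)
      invFun := fun x => match x with
        | NetworkVertex.source i => Sum.inl i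
        | NetworkVertex.sink j => Sum.inr (Sum.inl j)
        | NetworkVertex.inner v => Sum.inr (Sum.inr v)
      left_inv := by rintro (i | j | v) <;> rfl
      right_inv := by rintro (i | j | v) <;> rfl }

/-- The `i`-th boundary source. -/
def source (i : Fin m) : N.Vertex := NetworkVertex.source i

/-- The `j`-th boundary sink. -/
def sink (j : Fin n) : N.Vertex := NetworkVertex.sink j

/-- The internal vertex `v`. -/
def inner (v : I) : N.Vertex := NetworkVertex.inner v

/-- There are no oriented cycles. -/
def Acyclic : Prop := ∀ (a : N.Vertex) (p : Quiver.Path a a), p.length = 0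

/-- The edge `e`, as an arrow. -/
def arrow (e : E) : (show N.Vertex from N.src e) ⟶ (show N.Vertex from N.tgt e) := ⟨e, rfl, rfl⟩

section Bracket

variable (k : Type*) [Field k]

/-- The edge `e`, as an element of the path algebra. -/
def edge (e : E) : PathAlgebra k N.Vertex := PathAlgebra.ofPath k (N.arrow e).toPath

/-- The identity morphism of the internal vertex `v`. -/
def innerIdem (v : I) : PathAlgebra k N.Vertex := PathAlgebra.idem k (N.inner v)

/-- The internal vertex `v` is white, and `x₁, x₂, x₃` are the edges at `v` in counterclockwise
order, `x₃` being the only incoming one. -/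
def IsWhite (v : I) (x₁ x₂ x₃ : E) : Prop :=
  N.src x₁ = NetworkVertex.inner v ∧ N.src x₂ = NetworkVertex.inner v ∧
    N.tgt x₃ = NetworkVertex.inner v ∧
    N.rotation (Sum.inl x₁) = Sum.inl x₂ ∧ N.rotation (Sum.inl x₂) = Sum.inr x₃ ∧
    N.rotation (Sum.inr x₃) = Sum.inl x₁

/-- The internal vertex `v` is black, and `y₁, y₂, y₃` are the edges at `v` in counterclockwise
order, `y₃` being the only outgoing one. -/
def IsBlack (v : I) (y₁ y₂ y₃ : E) : Prop :=
  N.tgt y₁ = NetworkVertex.inner v ∧ N.tgt y₂ = NetworkVertex.inner v ∧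
    N.src y₃ = NetworkVertex.inner v ∧
    N.rotation (Sum.inr y₁) = Sum.inr y₂ ∧ N.rotation (Sum.inr y₂) = Sum.inl y₃ ∧
    N.rotation (Sum.inl y₃) = Sum.inr y₁

open Classical in
/-- The contribution of the internal vertex `v` to the bracket of the edges `e` and `f`, when these
are the edges with labels `1,2`, or `1,3`, or `2,3` in this order: at a white vertex
`⟦x₁,x₂⟧ = w₁₂ x₁ ⊗ x₂`, `⟦x₁,x₃⟧ = w₁₃ x₃x₁ ⊗ 𝟏`, `⟦x₂,x₃⟧ = w₂₃ x₃x₂ ⊗ 𝟏`, and at a black vertex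
`⟦y₁,y₂⟧ = b₁₂ y₂ ⊗ y₁`, `⟦y₁,y₃⟧ = b₁₃ 𝟏 ⊗ y₁y₃`, `⟦y₂,y₃⟧ = b₂₃ 𝟏 ⊗ y₂y₃`. -/
def vertexTerm (c : LocalWeights k) (v : I) (e f : E) :
    PathAlgebra k N.Vertex ⊗[k] PathAlgebra k N.Vertex :=
  (if ∃ x, N.IsWhite v e f x then c.w₁₂ • (N.edge k e ⊗ₜ[k] N.edge k f) else 0) +
  (if ∃ x, N.IsWhite v e x f then
    c.w₁₃ • ((N.edge k f * N.edge k e) ⊗ₜ[k] N.innerIdem k v) else 0) +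
  (if ∃ x, N.IsWhite v x e f then
    c.w₂₃ • ((N.edge k f * N.edge k e) ⊗ₜ[k] N.innerIdem k v) else 0) +
  (if ∃ y, N.IsBlack v e f y then c.b₁₂ • (N.edge k f ⊗ₜ[k] N.edge k e) else 0) +
  (if ∃ y, N.IsBlack v e y f then
    c.b₁₃ • (N.innerIdem k v ⊗ₜ[k] (N.edge k e * N.edge k f)) else 0) +
  (if ∃ y, N.IsBlack v y e f then
    c.b₂₃ • (N.innerIdem k v ⊗ₜ[k] (N.edge k e * N.edge k f)) else 0)

/-- The double bracket of two edges: the sum of the contributions of all internal vertices,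
completed by skew-symmetry. -/
def edgeBracket (c : LocalWeights k) (e f : E) :
    PathAlgebra k N.Vertex ⊗[k] PathAlgebra k N.Vertex :=
  ∑ v : I, (N.vertexTerm k c v e f - tensorSwap k N.Vertex (N.vertexTerm k c v f e))

theorem idem_mul_edge (e : E) {a : N.Vertex} (h : N.src e = a) :
    PathAlgebra.idem k a * N.edge k e = N.edge k e := by
  subst h; exact PathAlgebra.idem_mul_ofPath k _

theorem edge_mul_idem (e : E) {a : N.Vertex} (h : N.tgt e = a) :
    N.edge k e * PathAlgebra.idem k a = N.edge k e := by
  subst h; exact PathAlgebra.ofPath_mul_idem k _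

theorem idem_mul_innerIdem (v : I) {a : N.Vertex} (h : NetworkVertex.inner v = a) :
    PathAlgebra.idem k a * N.innerIdem k v = N.innerIdem k v := by
  subst h; exact PathAlgebra.idem_mul_idem k _

theorem innerIdem_mul_idem (v : I) {a : N.Vertex} (h : NetworkVertex.inner v = a) :
    N.innerIdem k v * PathAlgebra.idem k a = N.innerIdem k v := by
  subst h; exact PathAlgebra.idem_mul_idem k _

theorem vertexTerm_source (c : LocalWeights k) (v : I) (e f : E) {a b : N.Vertex}
    (ha : N.src e = a) (hb : N.src f = b) :
    (PathAlgebra.idem k b ⊗ₜ[k] PathAlgebra.idem k a) * N.vertexTerm k c v e f =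
      N.vertexTerm k c v e f := by
  unfold vertexTerm
  simp only [mul_add, mul_ite, mul_zero, mul_smul_comm, Algebra.TensorProduct.tmul_mul_tmul,
    ← mul_assoc, N.idem_mul_edge k e ha, N.idem_mul_edge k f hb]
  congr 1; congr 1; congr 1; congr 1; congr 1
  all_goals
    split_ifs with h
    swap
    · rfl
  · obtain ⟨x, h1, h2, h3, -⟩ := h
    rw [N.idem_mul_edge k e (h1.trans (h2.symm.trans hb)),
      N.idem_mul_edge k f (h2.trans (h1.symm.trans ha))]
  · obtain ⟨x, h1, h2, h3, -⟩ := h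
    rw [N.idem_mul_innerIdem k v (h1.symm.trans ha)]
  · obtain ⟨x, h1, h2, h3, -⟩ := h
    rw [N.idem_mul_innerIdem k v (h2.symm.trans ha)]
  · obtain ⟨x, h1, h2, h3, -⟩ := h
    rw [N.idem_mul_innerIdem k v (h3.symm.trans hb)]
  · obtain ⟨x, h1, h2, h3, -⟩ := h
    rw [N.idem_mul_innerIdem k v (h3.symm.trans hb)]

theorem vertexTerm_target (c : LocalWeights k) (v : I) (e f : E) {b d : N.Vertex}
    (hb : N.tgt e = b) (hd : N.tgt f = d) :
    N.vertexTerm k c v e f * (PathAlgebra.idem k b ⊗ₜ[k] PathAlgebra.idem k d) =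
      N.vertexTerm k c v e f := by
  unfold vertexTerm
  simp only [add_mul, ite_mul, zero_mul, smul_mul_assoc, Algebra.TensorProduct.tmul_mul_tmul,
    mul_assoc, N.edge_mul_idem k e hb, N.edge_mul_idem k f hd]
  congr 1; congr 1; congr 1; congr 1; congr 1
  all_goals
    split_ifs with h
    swap
    · rfl
  · obtain ⟨x, h1, h2, h3, -⟩ := h
    rw [N.innerIdem_mul_idem k v (h3.symm.trans hd)]
  · obtain ⟨x, h1, h2, h3, -⟩ := h
    rw [N.innerIdem_mul_idem k v (h3.symm.trans hd)]
  · obtain ⟨x, h1, h2, h3, -⟩ := h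
    rw [N.edge_mul_idem k e (h1.trans (h2.symm.trans hd)),
      N.edge_mul_idem k f (h2.trans (h1.symm.trans hb))]
  · obtain ⟨x, h1, h2, h3, -⟩ := h
    rw [N.innerIdem_mul_idem k v (h1.symm.trans hb)]
  · obtain ⟨x, h1, h2, h3, -⟩ := h
    rw [N.innerIdem_mul_idem k v (h2.symm.trans hb)]

theorem swap_swap (x : PathAlgebra k N.Vertex ⊗[k] PathAlgebra k N.Vertex) :
    tensorSwap k N.Vertex (tensorSwap k N.Vertex x) = x :=
  (TensorProduct.comm k (PathAlgebra k N.Vertex) (PathAlgebra k N.Vertex)).symm_apply_apply x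

/-- The local double brackets of all pairs of edges. -/
def arrowBracket (c : LocalWeights k) : ArrowBracket k N.Vertex where
  val e f := N.edgeBracket k c e.1 f.1
  source := by
    rintro a b a' b' ⟨e, ha, hb⟩ ⟨f, ha', hb'⟩
    have h := fun v => congrArg (tensorSwap k N.Vertex) (N.vertexTerm_source k c v f e ha' ha)
    simp only [ArrowBracket.swap_mul, ArrowBracket.swap_tmul] at h
    simp only [edgeBracket, Finset.mul_sum, mul_sub, N.vertexTerm_source k c _ e f ha ha', h]
  target := by
    rintro a b a' b' ⟨e, ha, hb⟩ ⟨f, ha', hb'⟩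
    have h := fun v => congrArg (tensorSwap k N.Vertex) (N.vertexTerm_target k c v f e hb' hb)
    simp only [ArrowBracket.swap_mul, ArrowBracket.swap_tmul] at h
    simp only [edgeBracket, Finset.sum_mul, sub_mul, N.vertexTerm_target k c _ e f hb hb', h]
  skew e f := by
    simp only [edgeBracket, map_sum, map_sub, swap_swap, ← Finset.sum_neg_distrib, neg_sub]

/-- The double bracket on the category of paths of the network with local weights `c`. -/
def doubleBracket (c : LocalWeights k) : DoubleBracket k N.Vertex :=
  (N.arrowBracket k c).toDoubleBracket

/-- The boundary measurement matrix: the `(i,j)` entry is the sum of all paths from the `i`-th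
source to the `j`-th sink. For an acyclic network there are finitely many of them
(`finite_path_of_acyclic`). -/
def boundaryMeasurement : Matrix (Fin m) (Fin n) (PathAlgebra k N.Vertex) :=
  Matrix.of fun i j => ∑ᶠ p : Quiver.Path (N.source i) (N.sink j), PathAlgebra.ofPath k p

end Bracket

theorem finite_path_of_length (a : N.Vertex) (l : ℕ) (b : N.Vertex) :
    {p : Quiver.Path a b | p.length ≤ l}.Finite := by
  induction l generalizing b with
  | zero =>
    refine Set.Subsingleton.finite ?_
    intro p hp q hq
    cases p with
    | cons p e => simp at hp
    | nil => exact (Quiver.Path.eq_nil_of_length_zero q (Nat.le_zero.mp hq)).symm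
  | succ l ih =>
    have hfin : ∀ c : N.Vertex, Finite (c ⟶ b) := fun c =>
      inferInstanceAs (Finite {e : E // N.src e = c ∧ N.tgt e = b})
    have h : (⋃ c : N.Vertex, Set.image2 (fun (p : Quiver.Path a c) (e : c ⟶ b) => p.cons e)
        {p | p.length ≤ l} Set.univ).Finite :=
      Set.finite_iUnion fun c => Set.Finite.image2 _ (ih c) (Set.toFinite _)
    refine (h.union (Set.Subsingleton.finite (s := {p : Quiver.Path a b | p.length = 0}) ?_)).subset
      ?_
    · intro p hp q hq
      cases p with
      | cons p e => simp at hp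
      | nil => exact (Quiver.Path.eq_nil_of_length_zero q hq).symm
    · intro p hp
      cases p with
      | nil => exact Or.inr rfl
      | cons p e =>
        refine Or.inl (Set.mem_iUnion.mpr ⟨_, p, ?_, e, Set.mem_univ _, rfl⟩)
        simpa using hp

theorem finite_path_of_acyclic (hN : N.Acyclic) (a b : N.Vertex) :
    Finite (Quiver.Path a b) := by
  classical
  let R : N.Vertex → Finset N.Vertex := fun b => Finset.univ.filter fun x =>
    Nonempty (Quiver.Path x b)
  have key : ∀ {b : N.Vertex} (p : Quiver.Path a b), p.length + (R a).card ≤ (R b).card := by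
    intro b p
    induction p with
    | nil => simp
    | @cons c d p e ih =>
      have hlt : R c ⊂ R d := by
        refine Finset.ssubset_iff_of_subset ?_ |>.mpr ⟨d, ?_, ?_⟩
        · intro x hx
          obtain ⟨q⟩ := (Finset.mem_filter.mp hx).2
          exact Finset.mem_filter.mpr ⟨Finset.mem_univ _, ⟨q.cons e⟩⟩
        · exact Finset.mem_filter.mpr ⟨Finset.mem_univ _, ⟨Quiver.Path.nil⟩⟩
        · intro hx
          obtain ⟨q⟩ := (Finset.mem_filter.mp hx).2
          exact absurd (hN d (q.cons e)) (by simp)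
      have := Finset.card_lt_card hlt
      simp only [Quiver.Path.length_cons]
      omega
  have h := N.finite_path_of_length a (R b).card b
  refine Set.finite_univ_iff.mp (h.subset fun p _ => ?_)
  have h' := key p
  exact le_trans (Nat.le_add_right _ _) h'

end Network

end PerfectPlanarNetwork

/-! ## Matrices over the path algebra -/

section Matrices

variable {k Q : Type*} [Field k] [Quiver Q] [Fintype Q]

/-- The matrix `⟦X,Y⟧ = ∑ ⟦x_ij, y_kl⟧ E_ij ⊠ E_kl`. -/
def DoubleBracket.matrixBracket {ι κ ι' κ' : Type*} (D : DoubleBracket k Q)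
    (X : Matrix ι κ (PathAlgebra k Q)) (Y : Matrix ι' κ' (PathAlgebra k Q)) :
    Matrix (ι × ι') (κ × κ') (PathAlgebra k Q ⊗[k] PathAlgebra k Q) :=
  Matrix.of fun p q => D.bracket (X p.1 q.1) (Y p.2 q.2)

/-- The matrix `X_L`, with entries `x_ij ⊗ 1`. -/
def matrixL {ι κ : Type*} (X : Matrix ι κ (PathAlgebra k Q)) :
    Matrix ι κ (PathAlgebra k Q ⊗[k] PathAlgebra k Q) :=
  X.map fun x => x ⊗ₜ[k] (1 : PathAlgebra k Q)

/-- The matrix `X_R`, with entries `1 ⊗ x_ij`. -/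
def matrixR {ι κ : Type*} (X : Matrix ι κ (PathAlgebra k Q)) :
    Matrix ι κ (PathAlgebra k Q ⊗[k] PathAlgebra k Q) :=
  X.map fun x => (1 : PathAlgebra k Q) ⊗ₜ[k] x

/-- The transposition `τ` of the tensor factors, applied to each entry of a matrix. -/
def matrixSwap {ι κ : Type*} (X : Matrix ι κ (PathAlgebra k Q ⊗[k] PathAlgebra k Q)) :
    Matrix ι κ (PathAlgebra k Q ⊗[k] PathAlgebra k Q) :=
  X.map (tensorSwap k Q)

/-- The twisted commutator `[X,Y]_τ = XY - (YX)^τ`. -/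
def twistedCommutator {ι : Type*} [Fintype ι]
    (X Y : Matrix ι ι (PathAlgebra k Q ⊗[k] PathAlgebra k Q)) :
    Matrix ι ι (PathAlgebra k Q ⊗[k] PathAlgebra k Q) :=
  X * Y - matrixSwap (Y * X)

variable (k Q) in
/-- The matrix `r_n = (1/2) ∑_{i<j} (E_ji ⊠ E_ij - E_ij ⊠ E_ji)`, with scalar entries regarded as
elements of the tensor square of the path algebra. -/
def rMatrix (n : ℕ) :
    Matrix (Fin n × Fin n) (Fin n × Fin n) (PathAlgebra k Q ⊗[k] PathAlgebra k Q) :=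
  Matrix.map
    ((1 / 2 : k) • ∑ i : Fin n, ∑ j : Fin n, if i < j then
      Matrix.single j i (1 : k) ⊗ₖ Matrix.single i j (1 : k) -
        Matrix.single i j (1 : k) ⊗ₖ Matrix.single j i (1 : k) else 0)
    (algebraMap k (PathAlgebra k Q ⊗[k] PathAlgebra k Q))

end Matrices

end

/-!
Every edge `e` carries an interval `[h (inl e), h (inr e)]`, whose ends are heights of the faces to
its right and to its left: the length of the interval is a positive flow through `e`, and a balanced
flow is the coboundary of a function on the faces because the disk satisfies Euler's formula.

Sweep the network from the sources by down-closed sets `S` of internal vertices. The edges crossing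
the cut at `S` have disjoint height intervals, just as the sources and the sinks have disjoint
positions on the boundary. Let `u i e` be the sum of the paths from source `i` that end with `e`. If
only the vertices in `S` contribute to the bracket, then for all `e` and `f` crossing the cut
`⦃u i e, u i' f⦄ = ½ (sgn (i - i') + sgn (h f - h e)) • u i' e ⊗ u i f`.
When a vertex is added to `S`, the brackets of its outgoing edges inherit the terms `sgn (i - i')`
from its incoming edges, while its own contribution replaces the signs of the incoming edges by
those of the outgoing ones. At `S = ∅` and at the sources both signs cancel, and when `S` contains
all internal vertices the formula is the theorem.
-/

/-! ## Functions on the half-edges of a map on the sphere -/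

section InvariantFunctions

variable {D : Type*}

/-- The group of permutations that preserve a function. It serves to express invariance under a
group as an inclusion of subgroups. -/
def invarianceGroup {M : Type*} (f : D → M) : Subgroup (Equiv.Perm D) where
  carrier := {g | ∀ x, f (g x) = f x}
  mul_mem' hg hg' x := (hg _).trans (hg' x)
  one_mem' _ := rfl
  inv_mem' {g} hg x := by rw [← hg (g⁻¹ x)]; simp

variable (K : Type*) [Field K]

/-- The functions that are constant on the orbits of a permutation group. For the groups generated
by the rotation of a map and by the permutation of its faces, these are the functions on the
vertices and on the faces. -/
def invariantFunctions (G : Subgroup (Equiv.Perm D)) : Submodule K (D → K) where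
  carrier := {f | G ≤ invarianceGroup f}
  add_mem' hf hf' _ hg x := congrArg₂ (· + ·) (hf hg x) (hf' hg x)
  zero_mem' _ _ _ := rfl
  smul_mem' c _ hf _ hg x := congrArg (c * ·) (hf hg x)

variable {K}

theorem mem_invariantFunctions_zpowers {σ : Equiv.Perm D} {f : D → K} :
    f ∈ invariantFunctions K (Subgroup.zpowers σ) ↔ ∀ x, f (σ x) = f x :=
  Subgroup.zpowers_le

theorem invariantFunctions_sup (G H : Subgroup (Equiv.Perm D)) :
    invariantFunctions K (G ⊔ H) = invariantFunctions K G ⊓ invariantFunctions K H :=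
  Submodule.ext fun f => sup_le_iff (c := invarianceGroup f)

theorem invariantFunctions_eq_range (G : Subgroup (Equiv.Perm D)) :
    invariantFunctions K G =
      LinearMap.range (LinearMap.funLeft K K (Quotient.mk (MulAction.orbitRel G D))) := by
  ext f
  constructor
  · refine fun hf => ⟨Quotient.lift f ?_, rfl⟩
    intro a b hab
    obtain ⟨g, rfl⟩ := MulAction.orbitRel_apply.mp hab
    exact hf g.2 b
  · rintro ⟨F, rfl⟩ g hg x
    exact congrArg F (Quotient.sound (MulAction.orbitRel_apply.mpr ⟨⟨g, hg⟩, rfl⟩))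

theorem finrank_invariantFunctions [Finite D] (G : Subgroup (Equiv.Perm D)) :
    Module.finrank K (invariantFunctions K G) = orbitCount G := by
  have : Finite (MulAction.orbitRel.Quotient G D) := Quotient.finite _
  have := Fintype.ofFinite (MulAction.orbitRel.Quotient G D)
  rw [invariantFunctions_eq_range, LinearMap.finrank_range_of_inj
    (LinearMap.funLeft_injective_of_surjective K K _ Quotient.mk_surjective)]
  exact (Module.finrank_fintype_fun_eq_card K).trans Nat.card_eq_fintype_card.symm

end InvariantFunctions

section Coboundary

variable {K D : Type*} [Field K]

variable (K) in
/-- The coboundary of a function on half-edges: its differences along the edges, whose halves are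
exchanged by the permutation `α`. -/
def coboundary (α : Equiv.Perm D) : (D → K) →ₗ[K] (D → K) :=
  LinearMap.funLeft K K α - LinearMap.id

theorem coboundary_apply (α : Equiv.Perm D) (f : D → K) (d : D) :
    coboundary K α f d = f (α d) - f d := rfl

theorem coboundary_skew {α : Equiv.Perm D} (hα : Function.Involutive α) (f : D → K) (d : D) :
    coboundary K α f (α d) = -coboundary K α f d := by
  rw [coboundary_apply, coboundary_apply, hα d, neg_sub]

theorem ker_coboundary (α : Equiv.Perm D) :
    LinearMap.ker (coboundary K α) = invariantFunctions K (Subgroup.zpowers α) := by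
  ext f
  rw [mem_invariantFunctions_zpowers, LinearMap.mem_ker, funext_iff]
  exact forall_congr' fun d => sub_eq_zero

theorem finrank_map_coboundary_add [Finite D] (α : Equiv.Perm D)
    (G : Subgroup (Equiv.Perm D)) :
    Module.finrank K ((invariantFunctions K G).map (coboundary K α)) +
      orbitCount (G ⊔ Subgroup.zpowers α) = orbitCount G := by
  have hker : (LinearMap.ker ((coboundary K α).domRestrict (invariantFunctions K G))).map
      (invariantFunctions K G).subtype = invariantFunctions K (G ⊔ Subgroup.zpowers α) := by
    rw [LinearMap.ker_domRestrict, Submodule.map_comap_subtype, ker_coboundary,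
      invariantFunctions_sup]
  rw [← finrank_invariantFunctions (K := K), ← finrank_invariantFunctions (K := K), ← hker,
    Submodule.finrank_map_subtype_eq, ← LinearMap.range_domRestrict]
  exact LinearMap.finrank_range_add_finrank_ker _

variable (K) in
/-- The functions that change sign under a permutation: for the exchange of the two halves of each
edge, these are the flows along the edges. -/
def skewFunctions (α : Equiv.Perm D) : Submodule K (D → K) :=
  LinearMap.ker (LinearMap.funLeft K K α + LinearMap.id)

theorem mem_skewFunctions {α : Equiv.Perm D} {f : D → K} :
    f ∈ skewFunctions K α ↔ ∀ d, f (α d) = -f d := by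
  rw [skewFunctions, LinearMap.mem_ker, funext_iff]
  exact forall_congr' fun d => add_eq_zero_iff_eq_neg

theorem map_coboundary_le_skewFunctions {α : Equiv.Perm D} (hα : Function.Involutive α)
    (S : Submodule K (D → K)) : S.map (coboundary K α) ≤ skewFunctions K α := by
  rintro _ ⟨f, -, rfl⟩
  exact mem_skewFunctions.mpr (coboundary_skew hα f)

theorem finrank_skewFunctions_le [Finite D] (α : Equiv.Perm D) :
    Module.finrank K (skewFunctions K α) ≤ orbitCount (Subgroup.zpowers α) := by
  let Orbit := MulAction.orbitRel.Quotient (Subgroup.zpowers α) D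
  have : Finite Orbit := Quotient.finite _
  have := Fintype.ofFinite Orbit
  let restriction : skewFunctions K α →ₗ[K] Orbit → K :=
    LinearMap.funLeft K K Quotient.out ∘ₗ (skewFunctions K α).subtype
  have hinj : Function.Injective restriction := by
    refine LinearMap.ker_eq_bot.mp (LinearMap.ker_eq_bot'.mpr fun f hf => Subtype.ext ?_)
    have hsq : f.1 * f.1 ∈ invariantFunctions K (Subgroup.zpowers α) :=
      mem_invariantFunctions_zpowers.mpr fun d => by
        simp only [Pi.mul_apply, mem_skewFunctions.mp f.2 d, neg_mul_neg]
    rw [invariantFunctions_eq_range] at hsq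
    obtain ⟨F, hF⟩ := hsq
    have hF_apply : ∀ d, F (Quotient.mk _ d) = f.1 d * f.1 d := congrFun hF
    funext d
    let d₀ : D := (Quotient.mk _ d : Orbit).out
    have hd₀ : f.1 d₀ = 0 := congrFun hf (Quotient.mk _ d)
    have hd : f.1 d * f.1 d = f.1 d₀ * f.1 d₀ := by
      rw [← hF_apply, ← hF_apply, Quotient.out_eq]
    rwa [hd₀, mul_zero, mul_self_eq_zero] at hd
  refine (LinearMap.finrank_le_finrank_of_injective hinj).trans_eq ?_
  exact (Module.finrank_fintype_fun_eq_card K).trans Nat.card_eq_fintype_card.symm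

theorem dotProduct_coboundary [Fintype D] {α : Equiv.Perm D} {w : D → K}
    (hw : w ∈ skewFunctions K α) (g : D → K) :
    w ⬝ᵥ coboundary K α g = -2 * (w ⬝ᵥ g) := by
  have hα : ∑ d, w d * g (α d) = -∑ d, w d * g d := by
    rw [← Equiv.sum_comp α fun d => w d * g d, ← Finset.sum_neg_distrib]
    exact Finset.sum_congr rfl fun d _ => by rw [mem_skewFunctions.mp hw, neg_mul, neg_neg]
  simp only [dotProduct, coboundary_apply, mul_sub, Finset.sum_sub_distrib, hα]
  ring

theorem apply_eq_of_mem_invariantFunctions_mul {σ α : Equiv.Perm D} (hα : Function.Involutive α)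
    {h : D → K} (hh : h ∈ invariantFunctions K (Subgroup.zpowers (σ * α))) (d : D) :
    h (σ d) = h (α d) := by
  have := mem_invariantFunctions_zpowers.mp hh (α d)
  rwa [Equiv.Perm.mul_apply, hα d] at this

theorem coboundary_dotProduct_eq_zero [Fintype D] {σ α : Equiv.Perm D}
    (hα : Function.Involutive α) {h g : D → K}
    (hh : h ∈ invariantFunctions K (Subgroup.zpowers (σ * α)))
    (hg : g ∈ invariantFunctions K (Subgroup.zpowers σ)) :
    coboundary K α h ⬝ᵥ g = 0 := by
  have hterm : ∀ d, coboundary K α h d * g d = h (σ d) * g (σ d) - h d * g d := fun d => by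
    rw [coboundary_apply, apply_eq_of_mem_invariantFunctions_mul hα hh,
      mem_invariantFunctions_zpowers.mp hg, sub_mul]
  simp only [dotProduct, hterm, Finset.sum_sub_distrib]
  rw [Equiv.sum_comp σ fun d => h d * g d, sub_self]

theorem zpowers_sup_zpowers (σ α : Equiv.Perm D) :
    Subgroup.zpowers σ ⊔ Subgroup.zpowers α = Subgroup.closure {σ, α} := by
  rw [Subgroup.zpowers_eq_closure, Subgroup.zpowers_eq_closure, ← Subgroup.closure_union,
    Set.singleton_union]

theorem zpowers_mul_sup_zpowers (σ α : Equiv.Perm D) :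
    Subgroup.zpowers (σ * α) ⊔ Subgroup.zpowers α = Subgroup.closure {σ, α} := by
  rw [← zpowers_sup_zpowers]
  have hα (G : Subgroup (Equiv.Perm D)) : α ∈ G ⊔ Subgroup.zpowers α :=
    (le_sup_right : Subgroup.zpowers α ≤ G ⊔ _) (Subgroup.mem_zpowers α)
  have hG (τ : Equiv.Perm D) : τ ∈ Subgroup.zpowers τ ⊔ Subgroup.zpowers α :=
    (le_sup_left : _ ≤ Subgroup.zpowers τ ⊔ _) (Subgroup.mem_zpowers τ)
  refine le_antisymm (sup_le ?_ le_sup_right) (sup_le ?_ le_sup_right) <;>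
    rw [Subgroup.zpowers_le]
  · exact mul_mem (hG σ) (hα _)
  · exact (Subgroup.mul_mem_cancel_right _ (hα _)).mp (hG (σ * α))

variable [LinearOrder K] [IsStrictOrderedRing K] {σ α : Equiv.Perm D}

theorem disjoint_map_coboundary [Finite D] (hα : Function.Involutive α) :
    Disjoint ((invariantFunctions K (Subgroup.zpowers σ)).map (coboundary K α))
      ((invariantFunctions K (Subgroup.zpowers (σ * α))).map (coboundary K α)) := by
  have := Fintype.ofFinite D
  rw [Submodule.disjoint_def]
  rintro _ ⟨g, hg, rfl⟩ ⟨h, hh, hgh⟩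
  rw [← dotProduct_self_eq_zero,
    dotProduct_coboundary (mem_skewFunctions.mpr (coboundary_skew hα g)), ← hgh,
    coboundary_dotProduct_eq_zero hα hh hg, mul_zero]

/-- The hypothesis `hE` is the half `E + 2 C ≤ V + F` of Euler's formula on the sphere. -/
theorem map_coboundary_sup_map_coboundary [Finite D] (hα : Function.Involutive α)
    (hE : orbitCount (Subgroup.zpowers α) + 2 * orbitCount (Subgroup.closure {σ, α}) ≤
      orbitCount (Subgroup.zpowers σ) + orbitCount (Subgroup.zpowers (σ * α))) :
    (invariantFunctions K (Subgroup.zpowers σ)).map (coboundary K α) ⊔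
        (invariantFunctions K (Subgroup.zpowers (σ * α))).map (coboundary K α) =
      skewFunctions K α := by
  refine Submodule.eq_of_le_of_finrank_le
    (sup_le (map_coboundary_le_skewFunctions hα _) (map_coboundary_le_skewFunctions hα _)) ?_
  have hdim := Submodule.finrank_sup_add_finrank_inf_eq
    ((invariantFunctions K (Subgroup.zpowers σ)).map (coboundary K α))
    ((invariantFunctions K (Subgroup.zpowers (σ * α))).map (coboundary K α))
  rw [(disjoint_map_coboundary hα).eq_bot, finrank_bot] at hdim
  have hV := finrank_map_coboundary_add (K := K) α (Subgroup.zpowers σ)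
  have hF := finrank_map_coboundary_add (K := K) α (Subgroup.zpowers (σ * α))
  rw [zpowers_sup_zpowers] at hV
  rw [zpowers_mul_sup_zpowers] at hF
  have hskew := finrank_skewFunctions_le (K := K) α
  omega

theorem exists_coboundary_eq_of_balanced [Fintype D] (hα : Function.Involutive α)
    (hE : orbitCount (Subgroup.zpowers α) + 2 * orbitCount (Subgroup.closure {σ, α}) ≤
      orbitCount (Subgroup.zpowers σ) + orbitCount (Subgroup.zpowers (σ * α)))
    {w : D → K} (hw : w ∈ skewFunctions K α)
    (hbalanced : ∀ g ∈ invariantFunctions K (Subgroup.zpowers σ), w ⬝ᵥ g = 0) :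
    ∃ h ∈ invariantFunctions K (Subgroup.zpowers (σ * α)), coboundary K α h = w := by
  have hw' := hw
  rw [← map_coboundary_sup_map_coboundary hα hE] at hw'
  obtain ⟨_, ⟨g, hg, rfl⟩, _, ⟨h, hh, rfl⟩, hsum⟩ := Submodule.mem_sup.mp hw'
  have hg_eq : coboundary K α g = w - coboundary K α h := eq_sub_of_add_eq hsum
  have hg_zero : coboundary K α g = 0 := by
    rw [← dotProduct_self_eq_zero,
      dotProduct_coboundary (mem_skewFunctions.mpr (coboundary_skew hα g)), hg_eq,
      sub_dotProduct, hbalanced g hg, coboundary_dotProduct_eq_zero hα hh hg, sub_zero, mul_zero]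
  exact ⟨h, hh, by rw [← hsum, hg_zero, zero_add]⟩

end Coboundary

/-! ## Flows, heights and colours in an acyclic perfect planar network -/

namespace PerfectPlanarNetwork

variable {m n : ℕ} {I E : Type*} [Fintype I] [Fintype E] {N : PerfectPlanarNetwork m n I E}

theorem exists_rank (hN : N.Acyclic) :
    ∃ r : N.Vertex → ℕ, ∀ e, r (N.src e) < r (N.tgt e) := by
  classical
  refine ⟨fun a => (Finset.univ.filter fun x : N.Vertex => Nonempty (Quiver.Path x a)).card,
    fun e => Finset.card_lt_card <| Finset.ssubset_iff_of_subset ?_ |>.mpr ⟨N.tgt e, ?_, ?_⟩⟩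
  · intro x hx
    obtain ⟨q⟩ := (Finset.mem_filter.mp hx).2
    exact Finset.mem_filter.mpr ⟨Finset.mem_univ _, ⟨q.cons (N.arrow e)⟩⟩
  · exact Finset.mem_filter.mpr ⟨Finset.mem_univ _, ⟨Quiver.Path.nil⟩⟩
  · intro hx
    obtain ⟨q⟩ := (Finset.mem_filter.mp hx).2
    exact Nat.succ_ne_zero _ (hN _ (q.cons (N.arrow e)))

theorem src_ne_tgt (hN : N.Acyclic) (e : E) : N.src e ≠ N.tgt e := by
  obtain ⟨r, hr⟩ := exists_rank hN
  exact fun h => (hr e).ne (congrArg r h)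

theorem exists_path_from_source (hN : N.Acyclic) (b : N.Vertex) :
    ∃ i, Nonempty (Quiver.Path (N.source i) b) := by
  obtain ⟨r, hr⟩ := exists_rank hN
  induction h : r b using Nat.strong_induction_on generalizing b with
  | _ l ih =>
    have of_edge : ∀ e, N.tgt e = b → ∃ i, Nonempty (Quiver.Path (N.source i) b) := by
      rintro e rfl
      obtain ⟨i, ⟨p⟩⟩ := ih _ (h ▸ hr e) (N.src e) rfl
      exact ⟨i, ⟨p.cons (N.arrow e)⟩⟩
    match b with
    | NetworkVertex.source i => exact ⟨i, ⟨Quiver.Path.nil⟩⟩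
    | NetworkVertex.sink j => exact of_edge _ ((N.tgt_eq_sink _ j).mpr rfl)
    | NetworkVertex.inner v =>
      obtain ⟨e, he⟩ := N.exists_incoming v
      exact of_edge e he

theorem exists_path_to_sink (hN : N.Acyclic) (a : N.Vertex) :
    ∃ j, Nonempty (Quiver.Path a (N.sink j)) := by
  obtain ⟨r, hr⟩ := exists_rank hN
  induction h : (∑ b, r b) - r a using Nat.strong_induction_on generalizing a with
  | _ l ih =>
    have of_edge : ∀ e, N.src e = a → ∃ j, Nonempty (Quiver.Path a (N.sink j)) := by
      rintro e rfl
      have hlt := hr e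
      have hle : r (N.tgt e) ≤ ∑ b, r b :=
        Finset.single_le_sum (f := r) (fun _ _ => Nat.zero_le _) (Finset.mem_univ _)
      obtain ⟨j, ⟨p⟩⟩ := ih _ (by omega) (N.tgt e) rfl
      exact ⟨j, ⟨(N.arrow e).toPath.comp p⟩⟩
    match a with
    | NetworkVertex.source i => exact of_edge _ ((N.src_eq_source _ i).mpr rfl)
    | NetworkVertex.sink j => exact ⟨j, ⟨Quiver.Path.nil⟩⟩
    | NetworkVertex.inner v =>
      obtain ⟨e, he⟩ := N.exists_outgoing v
      exact of_edge e he

section Flow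

theorem exists_unitFlow_of_edge (e : E) :
    ∃ w : E → ℚ, 0 ≤ w ∧ 0 < w e ∧
      ∀ G : N.Vertex → ℚ, ∑ e', w e' * (G (N.src e') - G (N.tgt e')) =
        G (N.src e) - G (N.tgt e) := by
  classical
  refine ⟨Pi.single e 1, Pi.single_nonneg.mpr zero_le_one, by simp, fun G => ?_⟩
  simp [Pi.single_apply]

theorem exists_unitFlow {a b : N.Vertex} (p : Quiver.Path a b) :
    ∃ w : E → ℚ, 0 ≤ w ∧
      ∀ G : N.Vertex → ℚ, ∑ e, w e * (G (N.src e) - G (N.tgt e)) = G a - G b := by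
  induction p with
  | nil => exact ⟨0, le_rfl, fun G => by simp⟩
  | cons _ f ih =>
    obtain ⟨f, hsrc, htgt⟩ := f
    obtain ⟨w, hw, hwG⟩ := ih
    obtain ⟨w', hw', -, hwG'⟩ := exists_unitFlow_of_edge (N := N) f
    refine ⟨w + w', add_nonneg hw hw', fun G => ?_⟩
    simp only [Pi.add_apply, add_mul, Finset.sum_add_distrib, hwG, hwG']
    rw [congrArg G hsrc, congrArg G htgt, sub_add_sub_cancel]

theorem exists_boundaryFlow (hN : N.Acyclic) (e : E) :
    ∃ w : E → ℚ, 0 ≤ w ∧ 0 < w e ∧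
      ∀ G : N.Vertex → ℚ, (∀ i j, G (N.source i) = G (N.sink j)) →
        ∑ e', w e' * (G (N.src e') - G (N.tgt e')) = 0 := by
  obtain ⟨i, ⟨p⟩⟩ := exists_path_from_source hN (N.src e)
  obtain ⟨j, ⟨q⟩⟩ := exists_path_to_sink hN (N.tgt e)
  obtain ⟨u, hu, huG⟩ := exists_unitFlow p
  obtain ⟨v, hv, hve, hvG⟩ := exists_unitFlow_of_edge (N := N) e
  obtain ⟨w, hw, hwG⟩ := exists_unitFlow q
  refine ⟨u + v + w, add_nonneg (add_nonneg hu hv) hw,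
    add_pos_of_pos_of_nonneg (add_pos_of_nonneg_of_pos (hu e) hve) (hw e), fun G hG => ?_⟩
  simp only [Pi.add_apply, add_mul, Finset.sum_add_distrib, huG, hvG, hwG, hG i j]
  ring

theorem exists_positive_boundaryFlow (hN : N.Acyclic) :
    ∃ w : E → ℚ, (∀ e, 0 < w e) ∧
      ∀ G : N.Vertex → ℚ, (∀ i j, G (N.source i) = G (N.sink j)) →
        ∑ e, w e * (G (N.src e) - G (N.tgt e)) = 0 := by
  choose w hw hpos hwG using exists_boundaryFlow hN
  refine ⟨∑ e, w e, fun e => ?_, fun G hG => ?_⟩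
  · rw [Finset.sum_apply]
    exact (hpos e).trans_le
      (Finset.single_le_sum (f := fun e' => w e' e) (fun e' _ => hw e' e) (Finset.mem_univ e))
  · simp only [Finset.sum_apply, Finset.sum_mul]
    rw [Finset.sum_comm]
    exact Finset.sum_eq_zero fun e _ => hwG e G hG

end Flow

section Boundary

theorem coe_finRotate_of_succ_lt {M : ℕ} {i : Fin M} (h : (i : ℕ) + 1 < M) :
    (finRotate M i : ℕ) = i + 1 := by
  cases M with
  | zero => exact i.elim0
  | succ M => exact coe_finRotate_of_ne_last fun hi => by simp [hi] at h

variable (N)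

/-- The half-edges at the boundary, numbered clockwise: first those at the sinks, from top to
bottom, then those at the sources, from bottom to top. -/
def boundaryHalf : Fin (n + m) → E ⊕ E :=
  Fin.append (fun j => Sum.inr (N.sinkEdge j)) fun i => Sum.inl (N.sourceEdge (Fin.rev i))

theorem boundaryHalf_castAdd (j : Fin n) :
    N.boundaryHalf (Fin.castAdd m j) = Sum.inr (N.sinkEdge j) := Fin.append_left _ _ _

theorem boundaryHalf_natAdd (i : Fin m) :
    N.boundaryHalf (Fin.natAdd n i.rev) = Sum.inl (N.sourceEdge i) := by
  rw [boundaryHalf, Fin.append_right, Fin.rev_rev]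

theorem rotation_boundaryHalf {i i' : Fin (n + m)} (h : (i : ℕ) + 1 = i') :
    N.rotation (N.boundaryHalf i) = N.boundaryHalf i' := by
  refine (N.rotation_boundary i).trans (congrArg N.boundaryHalf (Fin.ext ?_))
  rw [coe_finRotate_of_succ_lt (h ▸ i'.2), h]

theorem rotation_sinkEdge {j j' : Fin n} (h : (j : ℕ) + 1 = j') :
    N.rotation (Sum.inr (N.sinkEdge j)) = Sum.inr (N.sinkEdge j') := by
  rw [← boundaryHalf_castAdd, ← boundaryHalf_castAdd]
  exact N.rotation_boundaryHalf h

theorem rotation_sourceEdge {i i' : Fin m} (h : (i : ℕ) + 1 = i') :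
    N.rotation (Sum.inl (N.sourceEdge i')) = Sum.inl (N.sourceEdge i) := by
  rw [← boundaryHalf_natAdd, ← boundaryHalf_natAdd]
  refine N.rotation_boundaryHalf ?_
  simp only [Fin.val_natAdd, Fin.val_rev]
  omega

variable {N}

theorem apply_boundaryHalf_eq {M : Type*} {g : E ⊕ E → M} (hg : ∀ d, g (N.rotation d) = g d)
    (i i' : Fin (n + m)) : g (N.boundaryHalf i) = g (N.boundaryHalf i') := by
  have hzero : ∀ (l : ℕ) (hl : l < n + m),
      g (N.boundaryHalf ⟨l, hl⟩) = g (N.boundaryHalf ⟨0, Nat.zero_lt_of_lt hl⟩) := by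
    intro l hl
    induction l with
    | zero => rfl
    | succ l ih =>
      rw [← ih (by omega), ← hg (N.boundaryHalf ⟨l, _⟩),
        N.rotation_boundaryHalf (i' := ⟨l + 1, hl⟩) rfl]
  exact (hzero i i.2).trans (hzero i' i'.2).symm

/-- The vertex `∞` of the sphere is the image of all boundary vertices, hence the second
condition on `G`. -/
theorem exists_vertexFunction {M : Type*} {g : E ⊕ E → M} (hg : ∀ d, g (N.rotation d) = g d) :
    ∃ G : N.Vertex → M, (∀ d, g d = G (Sum.elim N.src N.tgt d)) ∧
      ∀ i j, G (N.source i) = G (N.sink j) := by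
  choose o ho using N.exists_incoming
  let G : N.Vertex → M := fun x => match x with
    | NetworkVertex.source i => g (Sum.inl (N.sourceEdge i))
    | NetworkVertex.sink j => g (Sum.inr (N.sinkEdge j))
    | NetworkVertex.inner v => g (Sum.inr (o v))
  have hG : ∀ d x, Sum.elim N.src N.tgt d = x → g d = G x := by
    rintro d (i | j | v) hd
    · rcases d with e | e
      · exact congrArg (fun e => g (Sum.inl e)) ((N.src_eq_source e i).mp hd)
      · exact absurd hd (N.tgt_ne_source e i)
    · rcases d with e | e
      · exact absurd hd (N.src_ne_sink e j)
      · exact congrArg (fun e => g (Sum.inr e)) ((N.tgt_eq_sink e j).mp hd)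
    · obtain ⟨l, hl⟩ := N.rotation_sameCycle v d (Sum.inr (o v)) hd (ho v)
      have hrot : N.rotation ^ l ∈ invarianceGroup g :=
        zpow_mem (show N.rotation ∈ invarianceGroup g from hg) l
      exact (hrot d).symm.trans (congrArg g hl)
  refine ⟨G, fun d => hG d _ rfl, fun i j => ?_⟩
  change g (Sum.inl (N.sourceEdge i)) = g (Sum.inr (N.sinkEdge j))
  rw [← boundaryHalf_castAdd, ← boundaryHalf_natAdd]
  exact apply_boundaryHalf_eq hg _ _

end Boundary

section Height

variable (N) in
/-- A height function on the faces for which every edge has the higher face on its left. Heights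
are recorded on half-edges: a half-edge carries the height of the face on its right, as seen from
its vertex, so that the edge `e` has height `h (Sum.inl e)` on its right and `h (Sum.inr e)` on its
left. -/
structure IsHeight (h : E ⊕ E → ℚ) : Prop where
  rotation : ∀ d, h (N.rotation d) = h d.swap
  lt : ∀ e, h (Sum.inl e) < h (Sum.inr e)

theorem exists_isHeight (hN : N.Acyclic) : ∃ h, N.IsHeight h := by
  obtain ⟨w, hpos, hw⟩ := exists_positive_boundaryFlow hN
  have hskew : Sum.elim w (-w) ∈ skewFunctions ℚ (Equiv.sumComm E E) :=
    mem_skewFunctions.mpr (by rintro (e | e) <;> simp)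
  have hbalanced : ∀ g ∈ invariantFunctions ℚ (Subgroup.zpowers N.rotation),
      Sum.elim w (-w) ⬝ᵥ g = 0 := by
    intro g hg
    obtain ⟨G, hG, hG_boundary⟩ := exists_vertexFunction (mem_invariantFunctions_zpowers.mp hg)
    have hterm : ∀ e, w e * g (Sum.inl e) + -w e * g (Sum.inr e) =
        w e * (G (N.src e) - G (N.tgt e)) := fun e => by
      have hsrc : g (Sum.inl e) = G (N.src e) := hG _
      have htgt : g (Sum.inr e) = G (N.tgt e) := hG _
      rw [hsrc, htgt]
      ring
    rw [dotProduct, Fintype.sum_sum_type, ← Finset.sum_add_distrib, ← hw G hG_boundary]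
    exact Finset.sum_congr rfl fun e _ => hterm e
  have hswap : Function.Involutive (Equiv.sumComm E E) := Sum.swap_swap
  obtain ⟨h, hh, hcoboundary⟩ :=
    exists_coboundary_eq_of_balanced hswap N.planar.ge hskew hbalanced
  refine ⟨h, apply_eq_of_mem_invariantFunctions_mul hswap hh, fun e => ?_⟩
  have hw_e : h (Sum.inr e) - h (Sum.inl e) = w e := congrFun hcoboundary (Sum.inl e)
  exact sub_pos.mp (hw_e ▸ hpos e)

end Height

section Colour

variable {v : I} {d d' : E ⊕ E} {e : E}

theorem rotation_ne_self (hd : Sum.elim N.src N.tgt d = .inner v) : N.rotation d ≠ d := by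
  intro hfix
  have heq : ∀ x, Sum.elim N.src N.tgt x = .inner v → x = d := by
    intro x hx
    obtain ⟨l, rfl⟩ := N.rotation_sameCycle v d x hd hx
    exact Equiv.Perm.zpow_apply_eq_self_of_apply_eq_self hfix l
  have hsub : Subsingleton {x : E ⊕ E // Sum.elim N.src N.tgt x = .inner v} :=
    ⟨fun x y => Subtype.ext ((heq x x.2).trans (heq y y.2).symm)⟩
  have hcard := Finite.card_le_one_iff_subsingleton.mpr hsub
  rw [N.trivalent v] at hcard
  omega

theorem card_support_cycleOf_rotation [DecidableEq E]
    (hd : Sum.elim N.src N.tgt d = .inner v) : (N.rotation.cycleOf d).support.card = 3 := by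
  classical
  have hpow : ∀ l : ℕ, Sum.elim N.src N.tgt ((N.rotation ^ l) d) = .inner v := by
    intro l
    induction l with
    | zero => exact hd
    | succ l ih =>
      rw [pow_succ', Equiv.Perm.mul_apply]
      exact N.rotation_inner v _ ih
  rw [← N.trivalent v, Nat.card_eq_fintype_card, Fintype.card_subtype]
  congr 1
  ext d'
  rw [Equiv.Perm.mem_support_cycleOf_iff' (rotation_ne_self hd), Finset.mem_filter_univ]
  constructor
  · intro hcycle
    obtain ⟨l, -, rfl⟩ := hcycle.exists_pow_eq'
    exact hpow l
  · exact N.rotation_sameCycle v d d' hd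

theorem rotation_rotation_rotation (hd : Sum.elim N.src N.tgt d = .inner v) :
    N.rotation (N.rotation (N.rotation d)) = d := by
  classical
  have hmod := N.rotation.pow_mod_card_support_cycleOf_self_apply 3 d
  rw [card_support_cycleOf_rotation hd] at hmod
  exact hmod.symm

theorem eq_or_eq_rotation_or_eq_rotation_rotation (hd : Sum.elim N.src N.tgt d = .inner v)
    (hd' : Sum.elim N.src N.tgt d' = .inner v) :
    d' = d ∨ d' = N.rotation d ∨ d' = N.rotation (N.rotation d) := by
  classical
  obtain ⟨l, hl, rfl⟩ := (N.rotation_sameCycle v d d' hd hd').exists_pow_eq_of_mem_support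
    (Equiv.Perm.mem_support.mpr (rotation_ne_self hd))
  rw [card_support_cycleOf_rotation hd] at hl
  interval_cases l
  exacts [Or.inl rfl, Or.inr (Or.inl rfl), Or.inr (Or.inr rfl)]

theorem isWhite_or_isBlack (v : I) :
    (∃ x₁ x₂ x₃, N.IsWhite v x₁ x₂ x₃) ∨ ∃ y₁ y₂ y₃, N.IsBlack v y₁ y₂ y₃ := by
  obtain ⟨a, ha⟩ := N.exists_incoming v
  obtain ⟨b, hb⟩ := N.exists_outgoing v
  have h1 := N.rotation_inner v (Sum.inr a) ha
  have h2 := N.rotation_inner v _ h1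
  have h3 := rotation_rotation_rotation (d := Sum.inr a) ha
  have hb' := eq_or_eq_rotation_or_eq_rotation_rotation (d := Sum.inr a) (d' := Sum.inl b) ha hb
  rcases hd : N.rotation (Sum.inr a) with x | x <;> rw [hd] at h1 h2 h3 hb' <;>
    rcases hd' : N.rotation _ with y | y <;> rw [hd'] at h2 h3 hb'
  · exact Or.inl ⟨x, y, a, h1, h2, ha, hd', h3, hd⟩
  · exact Or.inr ⟨y, a, x, h2, ha, h1, h3, hd, hd'⟩
  · exact Or.inr ⟨a, x, y, ha, h1, h2, hd, hd', h3⟩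
  · simp at hb'

theorem IsWhite.eq_of_tgt {x₁ x₂ x₃ : E} (hv : N.IsWhite v x₁ x₂ x₃) (he : N.tgt e = .inner v) :
    e = x₃ := by
  obtain ⟨-, -, h3, h12, -, h31⟩ := hv
  simpa [h31, h12] using
    eq_or_eq_rotation_or_eq_rotation_rotation (d := Sum.inr x₃) (d' := Sum.inr e) h3 he

theorem IsWhite.eq_or_eq_of_src {x₁ x₂ x₃ : E} (hv : N.IsWhite v x₁ x₂ x₃)
    (he : N.src e = .inner v) : e = x₁ ∨ e = x₂ := by
  obtain ⟨-, -, h3, h12, -, h31⟩ := hv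
  simpa [h31, h12] using
    eq_or_eq_rotation_or_eq_rotation_rotation (d := Sum.inr x₃) (d' := Sum.inl e) h3 he

theorem IsBlack.eq_of_src {y₁ y₂ y₃ : E} (hv : N.IsBlack v y₁ y₂ y₃) (he : N.src e = .inner v) :
    e = y₃ := by
  obtain ⟨-, -, h3, h12, -, h31⟩ := hv
  simpa [h31, h12] using
    eq_or_eq_rotation_or_eq_rotation_rotation (d := Sum.inl y₃) (d' := Sum.inl e) h3 he

theorem IsBlack.eq_or_eq_of_tgt {y₁ y₂ y₃ : E} (hv : N.IsBlack v y₁ y₂ y₃)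
    (he : N.tgt e = .inner v) : e = y₁ ∨ e = y₂ := by
  obtain ⟨-, -, h3, h12, -, h31⟩ := hv
  simpa [h31, h12] using
    eq_or_eq_rotation_or_eq_rotation_rotation (d := Sum.inl y₃) (d' := Sum.inr e) h3 he

end Colour

end PerfectPlanarNetwork

/-! ## Double brackets -/

theorem PathAlgebra.linearMap_ext {k Q M : Type*} [CommRing k] [Quiver Q] [AddCommGroup M]
    [Module k M] {φ ψ : PathAlgebra k Q →ₗ[k] M}
    (h : ∀ {a b : Q} (p : Quiver.Path a b), φ (ofPath k p) = ψ (ofPath k p)) : φ = ψ := by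
  ext x
  induction x using PathAlgebra.induction with
  | zero => rw [map_zero, map_zero]
  | add x y hx hy => rw [map_add, map_add, hx, hy]
  | smul r x hx => rw [map_smul, map_smul, hx]
  | path p => exact h p

namespace DoubleBracket

open PathAlgebra Algebra.TensorProduct

variable {k Q : Type*} [CommRing k] [Quiver Q] [Fintype Q]

theorem linearMap_eq_zero_of_leibniz
    {T : PathAlgebra k Q →ₗ[k] PathAlgebra k Q ⊗[k] PathAlgebra k Q}
    (leibniz : ∀ x y, T (x * y) = (x ⊗ₜ[k] 1) * T y + T x * (1 ⊗ₜ[k] y))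
    (idem_eq : ∀ a, T (idem k a) = 0)
    (arrow_eq : ∀ {a b : Q} (e : a ⟶ b), T (ofPath k e.toPath) = 0) : T = 0 := by
  refine linearMap_ext fun p => ?_
  induction p with
  | nil => exact idem_eq _
  | cons p e ih => rw [ofPath_cons, leibniz, arrow_eq, ih]; simp

section Leibniz

variable (D : DoubleBracket k Q)

theorem idem_tmul_idem_mul_bracket {a b c d : Q} (f : Quiver.Path a b) (g : Quiver.Path c d) :
    (idem k c ⊗ₜ[k] idem k a) * D.bracket (ofPath k f) (ofPath k g) =
      D.bracket (ofPath k f) (ofPath k g) := by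
  rw [← D.source_target f g, ← mul_assoc, ← mul_assoc, tmul_mul_tmul, idem_mul_idem,
    idem_mul_idem]

theorem bracket_mul_idem_tmul_idem {a b c d : Q} (f : Quiver.Path a b) (g : Quiver.Path c d) :
    D.bracket (ofPath k f) (ofPath k g) * (idem k b ⊗ₜ[k] idem k d) =
      D.bracket (ofPath k f) (ofPath k g) := by
  rw [← D.source_target f g, mul_assoc, tmul_mul_tmul, idem_mul_idem, idem_mul_idem]

theorem one_tmul_mul_bracket {a b c d c' d' : Q} (f : Quiver.Path a b) (g : Quiver.Path c d)
    (f' : Quiver.Path c' d') :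
    (1 ⊗ₜ[k] ofPath k f') * D.bracket (ofPath k f) (ofPath k g) =
      (idem k c ⊗ₜ[k] (ofPath k f' * idem k a)) * D.bracket (ofPath k f) (ofPath k g) := by
  conv_lhs => rw [← D.idem_tmul_idem_mul_bracket f g, ← mul_assoc, tmul_mul_tmul, one_mul]

theorem bracket_mul_tmul_one {a b c d c' d' : Q} (f : Quiver.Path a b) (g : Quiver.Path c d)
    (f' : Quiver.Path c' d') :
    D.bracket (ofPath k f) (ofPath k g) * (ofPath k f' ⊗ₜ[k] 1) =
      D.bracket (ofPath k f) (ofPath k g) * ((idem k b * ofPath k f') ⊗ₜ[k] idem k d) := by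
  conv_lhs => rw [← D.bracket_mul_idem_tmul_idem f g, mul_assoc, tmul_mul_tmul, mul_one]

theorem bracket_ofPath_mul_ofPath {a b c d s t : Q} (f : Quiver.Path a b) (g : Quiver.Path c d)
    (h : Quiver.Path s t) :
    D.bracket (ofPath k f * ofPath k g) (ofPath k h) =
      (1 ⊗ₜ[k] ofPath k f) * D.bracket (ofPath k g) (ofPath k h) +
        D.bracket (ofPath k f) (ofPath k h) * (ofPath k g ⊗ₜ[k] 1) := by
  rw [one_tmul_mul_bracket, bracket_mul_tmul_one]
  by_cases hcb : c = b
  · subst hcb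
    rw [D.leibniz_left, ofPath_mul_idem, idem_mul_ofPath]
  · have hf : ofPath k f * idem k c = 0 := ofPath_mul_ofPath_of_ne k f .nil hcb
    have hg : idem k b * ofPath k g = 0 := ofPath_mul_ofPath_of_ne k .nil g hcb
    rw [ofPath_mul_ofPath_of_ne k f g hcb, hf, hg, TensorProduct.tmul_zero,
      TensorProduct.zero_tmul, map_zero, LinearMap.zero_apply, zero_mul, mul_zero, add_zero]

theorem bracket_mul_left (x y z : PathAlgebra k Q) :
    D.bracket (x * y) z = (1 ⊗ₜ[k] x) * D.bracket y z + D.bracket x z * (y ⊗ₜ[k] 1) := by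
  induction z using PathAlgebra.induction with
  | zero => simp
  | add z z' hz hz' => rw [map_add, hz, hz', map_add, map_add, mul_add, add_mul]; abel
  | smul r z hz => simp only [map_smul, hz, smul_add, mul_smul_comm, smul_mul_assoc]
  | path h =>
  induction x using PathAlgebra.induction with
  | zero => simp
  | add x x' hx hx' =>
    simp only [add_mul, map_add, LinearMap.add_apply, hx, hx', TensorProduct.tmul_add]
    abel
  | smul r x hx =>
    simp only [map_smul, LinearMap.smul_apply, hx, smul_add, TensorProduct.tmul_smul,
      smul_mul_assoc]
  | path f =>
  induction y using PathAlgebra.induction with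
  | zero => simp
  | add y y' hy hy' =>
    simp only [mul_add, map_add, LinearMap.add_apply, hy, hy', TensorProduct.add_tmul]
    abel
  | smul r y hy =>
    simp only [mul_smul_comm, map_smul, LinearMap.smul_apply, hy, smul_add,
      ← TensorProduct.smul_tmul']
  | path g => exact D.bracket_ofPath_mul_ofPath f g h

theorem bracket_mul_right (x y z : PathAlgebra k Q) :
    D.bracket x (y * z) = (y ⊗ₜ[k] 1) * D.bracket x z + D.bracket x y * (1 ⊗ₜ[k] z) := by
  rw [D.skew, bracket_mul_left, map_add, ArrowBracket.swap_mul, ArrowBracket.swap_mul,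
    D.skew x z, D.skew x y, ArrowBracket.swap_tmul, ArrowBracket.swap_tmul, neg_add, mul_neg,
    neg_mul]

end Leibniz

section Casimir

/-- A Casimir element of a double bracket: an element whose bracket with every element is zero. -/
def IsCasimir (D : DoubleBracket k Q) (x : PathAlgebra k Q) : Prop := ∀ y, D.bracket x y = 0

variable {D : DoubleBracket k Q} {x x' : PathAlgebra k Q}

theorem IsCasimir.bracket_right (hx : D.IsCasimir x) (y : PathAlgebra k Q) :
    D.bracket y x = 0 := by
  rw [D.skew, hx, map_zero, neg_zero]

theorem IsCasimir.mul (hx : D.IsCasimir x) (hx' : D.IsCasimir x') : D.IsCasimir (x * x') := by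
  intro y
  rw [bracket_mul_left, hx, hx', mul_zero, zero_mul, add_zero]

theorem isCasimir_sum {ι : Type*} {s : Finset ι} {f : ι → PathAlgebra k Q}
    (h : ∀ i ∈ s, D.IsCasimir (f i)) : D.IsCasimir (∑ i ∈ s, f i) := by
  intro y
  rw [map_sum, LinearMap.sum_apply]
  exact Finset.sum_eq_zero fun i hi => h i hi y

theorem isCasimir_idem (a : Q) : D.IsCasimir (idem k a) := by
  refine DFunLike.congr_fun (linearMap_ext fun {s t} p => ?_ : D.bracket (idem k a) = 0)
  have hsource : (idem k s ⊗ₜ[k] idem k a) * D.bracket (idem k a) (ofPath k p) =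
      D.bracket (idem k a) (ofPath k p) := D.idem_tmul_idem_mul_bracket .nil p
  have htarget : D.bracket (idem k a) (ofPath k p) * (idem k a ⊗ₜ[k] idem k t) =
      D.bracket (idem k a) (ofPath k p) := D.bracket_mul_idem_tmul_idem .nil p
  have hleibniz : D.bracket (idem k a * idem k a) (ofPath k p) =
      (idem k s ⊗ₜ[k] idem k a) * D.bracket (idem k a) (ofPath k p) +
        D.bracket (idem k a) (ofPath k p) * (idem k a ⊗ₜ[k] idem k t) :=
    D.leibniz_left .nil .nil p
  rw [idem_mul_idem, hsource, htarget] at hleibniz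
  exact left_eq_add.mp hleibniz

theorem isCasimir_of_arrow
    (h : ∀ {a b : Q} (e : a ⟶ b), D.bracket x (ofPath k e.toPath) = 0) : D.IsCasimir x :=
  DFunLike.congr_fun <| linearMap_eq_zero_of_leibniz (D.bracket_mul_right x)
    (fun a => (isCasimir_idem a).bracket_right x) h

theorem IsCasimir.bracket_mul_left (hx : D.IsCasimir x) (y z : PathAlgebra k Q) :
    D.bracket (y * x) z = D.bracket y z * (x ⊗ₜ[k] 1) := by
  rw [DoubleBracket.bracket_mul_left, hx, mul_zero, zero_add]

theorem IsCasimir.bracket_mul_mul_right (hx : D.IsCasimir x) (hx' : D.IsCasimir x')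
    (y y' : PathAlgebra k Q) :
    D.bracket (y * x) (y' * x') = D.bracket y y' * (x ⊗ₜ[k] x') := by
  rw [hx.bracket_mul_left, bracket_mul_right, hx'.bracket_right, mul_zero, zero_add, mul_assoc,
    tmul_mul_tmul, one_mul, mul_one]

theorem IsCasimir.bracket_mul_mul_left (hx : D.IsCasimir x) (hx' : D.IsCasimir x')
    (y y' : PathAlgebra k Q) :
    D.bracket (x * y) (x' * y') = (x' ⊗ₜ[k] x) * D.bracket y y' := by
  rw [DoubleBracket.bracket_mul_left, hx, zero_mul, add_zero, bracket_mul_right,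
    hx'.bracket_right, zero_mul, add_zero, ← mul_assoc, tmul_mul_tmul, one_mul, mul_one]

end Casimir

theorem bracket_eq_add_of_arrow {D D₁ D₂ : DoubleBracket k Q}
    (h : ∀ {a b c d : Q} (e : a ⟶ b) (f : c ⟶ d),
      D.bracket (ofPath k e.toPath) (ofPath k f.toPath) =
        D₁.bracket (ofPath k e.toPath) (ofPath k f.toPath) +
          D₂.bracket (ofPath k e.toPath) (ofPath k f.toPath)) (x y : PathAlgebra k Q) :
    D.bracket x y = D₁.bracket x y + D₂.bracket x y := by
  have of_arrow : ∀ z, (∀ {a b : Q} (e : a ⟶ b), D.bracket z (ofPath k e.toPath) =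
      D₁.bracket z (ofPath k e.toPath) + D₂.bracket z (ofPath k e.toPath)) →
      ∀ y, D.bracket z y = D₁.bracket z y + D₂.bracket z y := by
    intro z hz y
    have hT : D.bracket z - (D₁.bracket z + D₂.bracket z) = 0 := by
      refine linearMap_eq_zero_of_leibniz (fun x y => ?_) (fun a => ?_) fun e => ?_
      · simp only [LinearMap.sub_apply, LinearMap.add_apply, bracket_mul_right, mul_sub, sub_mul,
          mul_add, add_mul]
        abel
      · simp only [LinearMap.sub_apply, LinearMap.add_apply, (isCasimir_idem a).bracket_right,
          add_zero, sub_zero]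
      · exact sub_eq_zero.mpr (hz e)
    exact sub_eq_zero.mp (DFunLike.congr_fun hT y)
  refine of_arrow x (fun e => ?_) y
  rw [D.skew, D₁.skew, D₂.skew, of_arrow _ (h e), map_add, neg_add]

theorem bracket_mul_mul_of_diverging {D : DoubleBracket k Q} {x y z e : PathAlgebra k Q}
    {α β γ : k} (hzz : D.bracket z z = 0) (hxz : D.bracket x z = α • ((z * x) ⊗ₜ[k] e))
    (hyz : D.bracket y z = β • ((z * y) ⊗ₜ[k] e)) (hxy : D.bracket x y = γ • (x ⊗ₜ[k] y))
    (hx : e * x = x) (hy : e * y = y) :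
    D.bracket (z * x) (z * y) = (γ + α - β) • ((z * x) ⊗ₜ[k] (z * y)) := by
  have hzy : D.bracket z y = -(β • (e ⊗ₜ[k] (z * y))) := by
    rw [D.skew, hyz, map_smul, ArrowBracket.swap_tmul]
  have hx_zy : D.bracket x (z * y) = (γ + α) • ((z * x) ⊗ₜ[k] y) := by
    rw [bracket_mul_right, hxy, hxz, mul_smul_comm, smul_mul_assoc, tmul_mul_tmul, tmul_mul_tmul,
      one_mul, mul_one, hy, add_smul]
  have hz_zy : D.bracket z (z * y) = -(β • ((z * e) ⊗ₜ[k] (z * y))) := by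
    rw [bracket_mul_right, hzz, hzy, zero_mul, add_zero, mul_neg, mul_smul_comm, tmul_mul_tmul,
      one_mul]
  rw [bracket_mul_left, hx_zy, hz_zy, mul_smul_comm, neg_mul, smul_mul_assoc, tmul_mul_tmul,
    tmul_mul_tmul, one_mul, mul_one, mul_assoc z e x, hx]
  module

theorem bracket_mul_self_of_diverging {D : DoubleBracket k Q} {x z e : PathAlgebra k Q} {α : k}
    (hzz : D.bracket z z = 0) (hxx : D.bracket x x = 0)
    (hxz : D.bracket x z = α • ((z * x) ⊗ₜ[k] e)) (hx : e * x = x) :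
    D.bracket (z * x) (z * x) = 0 := by
  rw [bracket_mul_mul_of_diverging hzz hxz hxz (hxx.trans (zero_smul k _).symm) hx hx, zero_add,
    sub_self, zero_smul]

theorem bracket_mul_mul_of_converging {D : DoubleBracket k Q} {x y z e : PathAlgebra k Q}
    {α β γ : k} (hzz : D.bracket z z = 0) (hxz : D.bracket x z = α • (e ⊗ₜ[k] (x * z)))
    (hyz : D.bracket y z = β • (e ⊗ₜ[k] (y * z))) (hxy : D.bracket x y = γ • (y ⊗ₜ[k] x))
    (hz : e * z = z) :
    D.bracket (x * z) (y * z) = (γ + α - β) • ((y * z) ⊗ₜ[k] (x * z)) := by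
  have hzy : D.bracket z y = -(β • ((y * z) ⊗ₜ[k] e)) := by
    rw [D.skew, hyz, map_smul, ArrowBracket.swap_tmul]
  have hx_yz : D.bracket x (y * z) = α • ((y * e) ⊗ₜ[k] (x * z)) + γ • (y ⊗ₜ[k] (x * z)) := by
    rw [bracket_mul_right, hxy, hxz, mul_smul_comm, smul_mul_assoc, tmul_mul_tmul, tmul_mul_tmul,
      one_mul, mul_one]
  have hz_yz : D.bracket z (y * z) = -(β • ((y * z) ⊗ₜ[k] z)) := by
    rw [bracket_mul_right, hzz, hzy, mul_zero, zero_add, neg_mul, smul_mul_assoc, tmul_mul_tmul,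
      mul_one, hz]
  rw [bracket_mul_left, hx_yz, hz_yz, mul_neg, mul_smul_comm, add_mul, smul_mul_assoc,
    smul_mul_assoc, tmul_mul_tmul, tmul_mul_tmul, tmul_mul_tmul, one_mul, mul_one,
    mul_assoc y e z, hz]
  module

theorem bracket_mul_self_of_converging {D : DoubleBracket k Q} {x z e : PathAlgebra k Q} {α : k}
    (hzz : D.bracket z z = 0) (hxx : D.bracket x x = 0)
    (hxz : D.bracket x z = α • (e ⊗ₜ[k] (x * z))) (hz : e * z = z) :
    D.bracket (x * z) (x * z) = 0 := by
  rw [bracket_mul_mul_of_converging hzz hxz hxz (hxx.trans (zero_smul k _).symm) hz, zero_add,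
    sub_self, zero_smul]

end DoubleBracket

/-! ## Brackets of partial networks -/

namespace PerfectPlanarNetwork

open PathAlgebra

variable {m n : ℕ} {I E : Type*} [Fintype I] [Fintype E]

section PartialBracket

variable (N : PerfectPlanarNetwork m n I E) (k : Type*) [Field k] (c : LocalWeights k)

/-- The contribution of the internal vertex `v` to the bracket of two edges, completed by
skew-symmetry: a summand of `edgeBracket`. -/
noncomputable def vertexBracket (v : I) (e f : E) :
    PathAlgebra k N.Vertex ⊗[k] PathAlgebra k N.Vertex :=
  N.vertexTerm k c v e f - tensorSwap k N.Vertex (N.vertexTerm k c v f e)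

theorem swap_vertexBracket (v : I) (e f : E) :
    tensorSwap k N.Vertex (N.vertexBracket k c v e f) = -N.vertexBracket k c v f e := by
  rw [vertexBracket, vertexBracket, map_sub, swap_swap, neg_sub]

theorem idem_tmul_idem_mul_vertexBracket (v : I) {e f : E} {a b : N.Vertex} (ha : N.src e = a)
    (hb : N.src f = b) :
    (idem k b ⊗ₜ[k] idem k a) * N.vertexBracket k c v e f = N.vertexBracket k c v e f := by
  have hswap := congrArg (tensorSwap k N.Vertex) (N.vertexTerm_source k c v f e hb ha)
  rw [ArrowBracket.swap_mul, ArrowBracket.swap_tmul] at hswap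
  rw [vertexBracket, mul_sub, N.vertexTerm_source k c v e f ha hb, hswap]

theorem vertexBracket_mul_idem_tmul_idem (v : I) {e f : E} {a b : N.Vertex} (ha : N.tgt e = a)
    (hb : N.tgt f = b) :
    N.vertexBracket k c v e f * (idem k a ⊗ₜ[k] idem k b) = N.vertexBracket k c v e f := by
  have hswap := congrArg (tensorSwap k N.Vertex) (N.vertexTerm_target k c v f e hb ha)
  rw [ArrowBracket.swap_mul, ArrowBracket.swap_tmul] at hswap
  rw [vertexBracket, sub_mul, N.vertexTerm_target k c v e f ha hb, hswap]

/-- The brackets of pairs of edges to which only the internal vertices in `S` contribute. -/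
noncomputable def arrowBracketOn (S : Finset I) : ArrowBracket k N.Vertex where
  val e f := ∑ v ∈ S, N.vertexBracket k c v e.1 f.1
  source e f := by
    simp only [Finset.mul_sum, idem_tmul_idem_mul_vertexBracket N k c _ e.2.1 f.2.1]
  target e f := by
    simp only [Finset.sum_mul, vertexBracket_mul_idem_tmul_idem N k c _ e.2.2 f.2.2]
  skew e f := by
    simp only [map_sum, swap_vertexBracket, Finset.sum_neg_distrib, neg_neg]

/-- The double bracket to which only the internal vertices in `S` contribute. The bracket of the
network is the case `S = univ`; it is reached by adding one vertex at a time. -/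
noncomputable def bracketOn (S : Finset I) : DoubleBracket k N.Vertex :=
  (N.arrowBracketOn k c S).toDoubleBracket

theorem bracketOn_univ : N.bracketOn k c Finset.univ = N.doubleBracket k c := rfl

theorem ofPath_toPath {a b : N.Vertex} (f : a ⟶ b) : ofPath k f.toPath = N.edge k f.1 := by
  obtain ⟨f, rfl, rfl⟩ := f
  rfl

theorem ofPath_cons_eq_mul_edge {a b b' : N.Vertex} (p : Quiver.Path a b) (f : b ⟶ b') :
    ofPath k (p.cons f) = ofPath k p * N.edge k f.1 := by
  rw [ofPath_cons, ofPath_toPath]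

end PartialBracket

variable {N : PerfectPlanarNetwork m n I E} {k : Type*} [Field k] {c : LocalWeights k}
  {S : Finset I} {v : I}

theorem bracketOn_edge (e f : E) :
    (N.bracketOn k c S).bracket (N.edge k e) (N.edge k f) =
      ∑ v ∈ S, N.vertexBracket k c v e f :=
  ArrowBracket.toDoubleBracket_arrow _ _ _

theorem isCasimir_edge {e : E} (h : ∀ v ∈ S, N.src e ≠ .inner v ∧ N.tgt e ≠ .inner v) :
    (N.bracketOn k c S).IsCasimir (N.edge k e) := by
  refine DoubleBracket.isCasimir_of_arrow fun f => ?_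
  rw [ofPath_toPath, bracketOn_edge]
  refine Finset.sum_eq_zero fun v hv => ?_
  obtain ⟨hsrc, htgt⟩ := h v hv
  simp [vertexBracket, vertexTerm, IsWhite, IsBlack, hsrc, htgt]

theorem bracketOn_insert [DecidableEq I] (hv : v ∉ S) (x y : PathAlgebra k N.Vertex) :
    (N.bracketOn k c (insert v S)).bracket x y =
      (N.bracketOn k c S).bracket x y + (N.bracketOn k c {v}).bracket x y := by
  refine DoubleBracket.bracket_eq_add_of_arrow (fun e f => ?_) x y
  simp only [ofPath_toPath, bracketOn_edge, Finset.sum_insert hv, Finset.sum_singleton]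
  exact add_comm _ _

theorem vertexTerm_self (hN : N.Acyclic) (e : E) : N.vertexTerm k c v e e = 0 := by
  have hW : ∀ x, ¬N.IsWhite v e e x := fun x h => by simpa [h.2.2.2.1] using h.2.2.2.2.1
  have hB : ∀ y, ¬N.IsBlack v e e y := fun y h => by simpa [h.2.2.2.1] using h.2.2.2.2.1
  have hloop : N.src e = .inner v → N.tgt e ≠ .inner v :=
    fun h h' => src_ne_tgt hN e (h.trans h'.symm)
  simp only [vertexTerm, hW, hB, exists_false, if_false, add_zero, zero_add]
  simp only [IsWhite, IsBlack]
  grind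

theorem bracketOn_singleton_edge (e f : E) :
    (N.bracketOn k c {v}).bracket (N.edge k e) (N.edge k f) = N.vertexBracket k c v e f := by
  rw [bracketOn_edge, Finset.sum_singleton]

theorem bracketOn_singleton_edge_self (hN : N.Acyclic) (e : E) :
    (N.bracketOn k c {v}).bracket (N.edge k e) (N.edge k e) = 0 := by
  rw [bracketOn_singleton_edge, vertexBracket, vertexTerm_self hN, map_zero, sub_zero]

theorem IsWhite.vertexBracket {x₁ x₂ x₃ : E} (h : N.IsWhite v x₁ x₂ x₃) (hN : N.Acyclic) :
    N.vertexBracket k c v x₁ x₂ = c.w₁₂ • (N.edge k x₁ ⊗ₜ[k] N.edge k x₂) ∧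
      N.vertexBracket k c v x₁ x₃ =
        c.w₁₃ • ((N.edge k x₃ * N.edge k x₁) ⊗ₜ[k] N.innerIdem k v) ∧
      N.vertexBracket k c v x₂ x₃ =
        c.w₂₃ • ((N.edge k x₃ * N.edge k x₂) ⊗ₜ[k] N.innerIdem k v) := by
  obtain ⟨h1, h2, h3, r1, r2, r3⟩ := h
  have l1 : N.tgt x₁ ≠ .inner v := fun h => src_ne_tgt hN x₁ (h1.trans h.symm)
  have l2 : N.tgt x₂ ≠ .inner v := fun h => src_ne_tgt hN x₂ (h2.trans h.symm)
  have l3 : N.src x₃ ≠ .inner v := fun h => src_ne_tgt hN x₃ (h.trans h3.symm)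
  have hne : x₁ ≠ x₂ := by
    rintro rfl
    simp [r1] at r2
  simp only [PerfectPlanarNetwork.vertexBracket, vertexTerm, IsWhite, IsBlack]
  refine ⟨?_, ?_, ?_⟩ <;> simp [h1, h2, h3, r1, r2, r3, l1, l2, l3, hne]

theorem IsBlack.vertexBracket {y₁ y₂ y₃ : E} (h : N.IsBlack v y₁ y₂ y₃) (hN : N.Acyclic) :
    N.vertexBracket k c v y₁ y₂ = c.b₁₂ • (N.edge k y₂ ⊗ₜ[k] N.edge k y₁) ∧
      N.vertexBracket k c v y₁ y₃ =
        c.b₁₃ • (N.innerIdem k v ⊗ₜ[k] (N.edge k y₁ * N.edge k y₃)) ∧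
      N.vertexBracket k c v y₂ y₃ =
        c.b₂₃ • (N.innerIdem k v ⊗ₜ[k] (N.edge k y₂ * N.edge k y₃)) := by
  obtain ⟨h1, h2, h3, r1, r2, r3⟩ := h
  have l1 : N.src y₁ ≠ .inner v := fun h => src_ne_tgt hN y₁ (h.trans h1.symm)
  have l2 : N.src y₂ ≠ .inner v := fun h => src_ne_tgt hN y₂ (h.trans h2.symm)
  have l3 : N.tgt y₃ ≠ .inner v := fun h => src_ne_tgt hN y₃ (h3.trans h.symm)
  have hne : y₁ ≠ y₂ := by
    rintro rfl
    simp [r1] at r2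
  simp only [PerfectPlanarNetwork.vertexBracket, vertexTerm, IsWhite, IsBlack]
  refine ⟨?_, ?_, ?_⟩ <;> simp [h1, h2, h3, r1, r2, r3, l1, l2, l3, hne]

end PerfectPlanarNetwork

/-! ## Sums of paths -/

namespace PerfectPlanarNetwork

open PathAlgebra

variable {m n : ℕ} {I E : Type*} [Fintype I] [Fintype E] (N : PerfectPlanarNetwork m n I E)
  (k : Type*) [Field k]

/-- The sum of all paths from the `i`-th source to the vertex `b`: the boundary measurement, with
`b` in place of a sink. -/
noncomputable def pathSum (i : Fin m) (b : N.Vertex) : PathAlgebra k N.Vertex :=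
  ∑ᶠ p : Quiver.Path (N.source i) b, ofPath k p

/-- The sum of all paths from the `i`-th source whose last edge is `e`: the entry which
corresponds to `e` in the boundary measurement matrix of the part of the network before a cut. -/
noncomputable def edgeSum (i : Fin m) (e : E) : PathAlgebra k N.Vertex :=
  N.pathSum k i (N.src e) * N.edge k e

variable {N k}

theorem bijective_cons {a b : N.Vertex} (hb : b ≠ a) :
    Function.Bijective fun x : Σ e : {e : E // N.tgt e = b}, Quiver.Path a (N.src e.1) =>
      (x.2.cons ⟨x.1.1, rfl, x.1.2⟩ : Quiver.Path a b) := by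
  have edge_eq : ∀ {s s' : N.Vertex} (f : s ⟶ b) (f' : s' ⟶ b), s = s' → f ≍ f' → f.1 = f'.1 := by
    rintro s _ f f' rfl h
    rw [eq_of_heq h]
  constructor
  · rintro ⟨⟨e, he⟩, p⟩ ⟨⟨e', he'⟩, p'⟩ h
    obtain ⟨hsrc, hp, hf⟩ := Quiver.Path.cons.inj h
    obtain rfl : e = e' := edge_eq _ _ hsrc hf
    obtain rfl := eq_of_heq hp
    rfl
  · intro p
    cases p with
    | nil => exact absurd rfl hb
    | cons p f =>
      obtain ⟨f, rfl, hf⟩ := f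
      exact ⟨⟨⟨f, hf⟩, p⟩, rfl⟩

theorem pathSum_eq_sum_edgeSum (hN : N.Acyclic) {i : Fin m} {b : N.Vertex} (hb : b ≠ N.source i)
    [DecidablePred fun e => N.tgt e = b] :
    N.pathSum k i b = ∑ e with N.tgt e = b, N.edgeSum k i e := by
  have := N.finite_path_of_acyclic hN (N.source i)
  have := fun b => Fintype.ofFinite (Quiver.Path (N.source i) b)
  have := fun e : {e : E // N.tgt e = b} => this (N.src e.1)
  have hedge : ∀ e : {e : E // N.tgt e = b}, N.edgeSum k i e =
      ∑ p : Quiver.Path (N.source i) (N.src e.1), ofPath k p * N.edge k e := fun e => by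
    rw [← Finset.sum_mul]
    exact congrArg (· * N.edge k e.1) (finsum_eq_sum_of_fintype _)
  rw [pathSum, ← finsum_comp_equiv (Equiv.ofBijective _ (bijective_cons hb)),
    finsum_eq_sum_of_fintype, Fintype.sum_sigma,
    Finset.sum_subtype (p := fun e => N.tgt e = b) _ (by simp)]
  refine Finset.sum_congr rfl fun e _ => (Finset.sum_congr rfl fun p _ => ?_).trans (hedge e).symm
  exact N.ofPath_cons_eq_mul_edge k _ _

theorem edgeSum_eq_sum (hN : N.Acyclic) {v : I} {x : E} (hx : N.src x = .inner v) (i : Fin m)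
    [DecidablePred fun e => N.tgt e = .inner v] :
    N.edgeSum k i x = ∑ e with N.tgt e = .inner v, N.edgeSum k i e * N.edge k x := by
  have hsum : N.pathSum k i (N.src x) = ∑ e with N.tgt e = .inner v, N.edgeSum k i e :=
    (congrArg (N.pathSum k i) hx).trans (pathSum_eq_sum_edgeSum hN (by rintro ⟨⟩))
  rw [edgeSum, hsum, Finset.sum_mul]

theorem pathSum_source_of_ne (hN : N.Acyclic) {i i' : Fin m} (h : i ≠ i') :
    N.pathSum k i (N.source i') = 0 := by
  classical
  rw [pathSum_eq_sum_edgeSum hN (by rintro ⟨⟩; exact h rfl)]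
  refine Finset.sum_eq_zero fun e he => ?_
  exact absurd (Finset.mem_filter.mp he).2 (N.tgt_ne_source e i')

theorem boundaryMeasurement_apply (hN : N.Acyclic) (i : Fin m) (j : Fin n) :
    N.boundaryMeasurement k i j = N.edgeSum k i (N.sinkEdge j) := by
  classical
  have hincoming : ({e | N.tgt e = N.sink j} : Finset E) = {N.sinkEdge j} := by
    ext e
    rw [Finset.mem_filter_univ, Finset.mem_singleton]
    exact N.tgt_eq_sink e j
  exact (pathSum_eq_sum_edgeSum hN (by rintro ⟨⟩)).trans (by rw [hincoming, Finset.sum_singleton])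

theorem edgeSum_sourceEdge_of_ne (hN : N.Acyclic) {i a : Fin m} (h : i ≠ a) :
    N.edgeSum k i (N.sourceEdge a) = 0 := by
  have hsrc : N.src (N.sourceEdge a) = N.source a := (N.src_eq_source _ a).mpr rfl
  have hzero : N.pathSum k i (N.src (N.sourceEdge a)) = 0 :=
    (congrArg (N.pathSum k i) hsrc).trans (pathSum_source_of_ne hN h)
  rw [edgeSum, hzero, zero_mul]

end PerfectPlanarNetwork

/-! ## Heights around a vertex -/

/-- The sign of `x - y`, as an element of `k`. -/
def ordSign (k : Type*) [Ring k] {α : Type*} [LinearOrder α] (x y : α) : k :=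
  if x < y then -1 else if y < x then 1 else 0

section OrdSign

variable {k : Type*} [Ring k] {α β : Type*} [LinearOrder α] [LinearOrder β] {x y : α}

theorem ordSign_of_lt (h : x < y) : ordSign k x y = -1 := if_pos h

theorem ordSign_of_gt (h : y < x) : ordSign k x y = 1 := by
  rw [ordSign, if_neg h.not_gt, if_pos h]

theorem ordSign_self (x : α) : ordSign k x x = 0 := by simp [ordSign]

theorem ordSign_swap (x y : α) : ordSign k y x = -ordSign k x y := by
  rcases lt_trichotomy x y with h | rfl | h
  · rw [ordSign_of_lt h, ordSign_of_gt h, neg_neg]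
  · rw [ordSign_self, neg_zero]
  · rw [ordSign_of_lt h, ordSign_of_gt h]

theorem ordSign_apply_of_strictAnti {f : α → β} (hf : StrictAnti f) (x y : α) :
    ordSign k (f x) (f y) = ordSign k y x := by
  rcases lt_trichotomy x y with h | rfl | h
  · rw [ordSign_of_gt h, ordSign_of_gt (hf h)]
  · rw [ordSign_self, ordSign_self]
  · rw [ordSign_of_lt h, ordSign_of_lt (hf h)]

end OrdSign

namespace PerfectPlanarNetwork

variable {E : Type*} {h : E ⊕ E → ℚ}

/-- The edges `e` and `f` are separated: their height intervals `[h (inl e), h (inr e)]` and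
`[h (inl f), h (inr f)]` have disjoint interiors. -/
def Separated (h : E ⊕ E → ℚ) (e f : E) : Prop :=
  h (.inr e) ≤ h (.inl f) ∨ h (.inr f) ≤ h (.inl e)

theorem Separated.symm {e f : E} (hef : Separated h e f) : Separated h f e := Or.symm hef

variable {m n : ℕ} {I : Type*} [Fintype I] [Fintype E] {N : PerfectPlanarNetwork m n I E} {v : I}

namespace IsHeight

variable (hh : N.IsHeight h)
include hh

theorem height_white {x₁ x₂ x₃ : E} (hv : N.IsWhite v x₁ x₂ x₃) :
    h (.inl x₁) = h (.inl x₃) ∧ h (.inr x₁) = h (.inl x₂) ∧ h (.inr x₂) = h (.inr x₃) := by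
  obtain ⟨-, -, -, r₁, r₂, r₃⟩ := hv
  exact ⟨r₃ ▸ hh.rotation (.inr x₃), (r₁ ▸ hh.rotation (.inl x₁)).symm,
    (r₂ ▸ hh.rotation (.inl x₂)).symm⟩

theorem height_black {y₁ y₂ y₃ : E} (hv : N.IsBlack v y₁ y₂ y₃) :
    h (.inl y₂) = h (.inl y₃) ∧ h (.inr y₂) = h (.inl y₁) ∧ h (.inr y₁) = h (.inr y₃) := by
  obtain ⟨-, -, -, r₁, r₂, r₃⟩ := hv
  exact ⟨(r₂ ▸ hh.rotation (.inr y₂)).symm, r₁ ▸ hh.rotation (.inr y₁),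
    r₃ ▸ hh.rotation (.inl y₃)⟩

theorem separated_of_src {x y : E} (hx : N.src x = .inner v) (hy : N.src y = .inner v)
    (hne : x ≠ y) : Separated h x y := by
  rcases isWhite_or_isBlack (N := N) v with ⟨x₁, x₂, x₃, hv⟩ | ⟨y₁, y₂, y₃, hv⟩
  · obtain ⟨-, h12, -⟩ := hh.height_white hv
    rcases hv.eq_or_eq_of_src hx with rfl | rfl <;> rcases hv.eq_or_eq_of_src hy with rfl | rfl
    exacts [absurd rfl hne, .inl h12.le, .inr h12.le, absurd rfl hne]
  · exact absurd ((hv.eq_of_src hx).trans (hv.eq_of_src hy).symm) hne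

theorem below_or_above {f : E} (hf : ∀ e, N.tgt e = .inner v → Separated h e f) :
    (∀ e, N.src e = .inner v ∨ N.tgt e = .inner v → h (.inr f) ≤ h (.inl e)) ∨
      ∀ e, N.src e = .inner v ∨ N.tgt e = .inner v → h (.inr e) ≤ h (.inl f) := by
  have hlt := hh.lt
  rcases isWhite_or_isBlack (N := N) v with ⟨x₁, x₂, x₃, hv⟩ | ⟨y₁, y₂, y₃, hv⟩
  · obtain ⟨h13, h12, h23⟩ := hh.height_white hv
    have hedge : ∀ e, N.src e = .inner v ∨ N.tgt e = .inner v →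
        h (.inl x₃) ≤ h (.inl e) ∧ h (.inr e) ≤ h (.inr x₃) := by
      rintro e (he | he)
      · rcases hv.eq_or_eq_of_src he with rfl | rfl
        · exact ⟨h13.ge, by linarith [hlt x₂]⟩
        · exact ⟨by linarith [hlt x₁], h23.le⟩
      · rw [hv.eq_of_tgt he]
        exact ⟨le_rfl, le_rfl⟩
    rcases hf x₃ hv.2.2.1 with h3 | h3
    · exact .inr fun e he => (hedge e he).2.trans h3
    · exact .inl fun e he => h3.trans (hedge e he).1
  · obtain ⟨h23, h12, h13⟩ := hh.height_black hv
    have hedge : ∀ e, N.src e = .inner v ∨ N.tgt e = .inner v →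
        h (.inl y₂) ≤ h (.inl e) ∧ h (.inr e) ≤ h (.inr y₁) := by
      rintro e (he | he)
      · rw [hv.eq_of_src he]
        exact ⟨h23.le, h13.ge⟩
      · rcases hv.eq_or_eq_of_tgt he with rfl | rfl
        · exact ⟨by linarith [hlt y₂], le_rfl⟩
        · exact ⟨le_rfl, by linarith [hlt y₁]⟩
    rcases hf y₁ hv.1 with h1 | h1
    · exact .inr fun e he => (hedge e he).2.trans h1
    · rcases hf y₂ hv.2.1 with h2 | h2
      · linarith [hlt f]
      · exact .inl fun e he => h2.trans (hedge e he).1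

theorem separated_of_separated_incoming {f x : E} (hx : N.src x = .inner v)
    (hf : ∀ e, N.tgt e = .inner v → Separated h e f) : Separated h x f :=
  (hh.below_or_above hf).elim (fun hbelow => .inr (hbelow x (.inl hx)))
    fun habove => .inl (habove x (.inl hx))

theorem ordSign_outgoing_eq_incoming (k : Type*) [Ring k] {e f x : E} (he : N.tgt e = .inner v)
    (hx : N.src x = .inner v) (hf : ∀ e, N.tgt e = .inner v → Separated h e f) :
    ordSign k (h (.inl f)) (h (.inl x)) = ordSign k (h (.inl f)) (h (.inl e)) := by
  rcases hh.below_or_above hf with hbelow | habove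
  · rw [ordSign_of_lt ((hh.lt f).trans_le (hbelow x (.inl hx))),
      ordSign_of_lt ((hh.lt f).trans_le (hbelow e (.inr he)))]
  · rw [ordSign_of_gt ((hh.lt x).trans_le (habove x (.inl hx))),
      ordSign_of_gt ((hh.lt e).trans_le (habove e (.inr he)))]

theorem height_sourceEdge_le {i i' : Fin m} (hi : i < i') :
    h (.inr (N.sourceEdge i')) ≤ h (.inl (N.sourceEdge i)) := by
  obtain ⟨i', hi'⟩ := i'
  induction i' with
  | zero => exact absurd hi (Nat.not_lt_zero _)
  | succ l ih =>
    have hl : l < m := Nat.lt_of_succ_lt hi'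
    have hstep := hh.rotation (.inl (N.sourceEdge ⟨l + 1, hi'⟩))
    rw [N.rotation_sourceEdge (i := ⟨l, hl⟩) rfl, Sum.swap_inl] at hstep
    rw [← hstep]
    rcases (Nat.lt_succ_iff.mp hi : (i : ℕ) ≤ l).lt_or_eq with hil | hil
    · exact (hh.lt _).le.trans (ih hl hil)
    · rw [show i = ⟨l, hl⟩ from Fin.ext hil]

theorem strictAnti_height_sourceEdge : StrictAnti fun i => h (.inl (N.sourceEdge i)) :=
  fun _ _ hi => (hh.lt _).trans_le (hh.height_sourceEdge_le hi)

theorem strictAnti_height_sinkEdge : StrictAnti fun j => h (.inl (N.sinkEdge j)) := by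
  rintro j ⟨j', hj'⟩ hj
  induction j' with
  | zero => exact absurd hj (Nat.not_lt_zero _)
  | succ l ih =>
    have hl : l < n := Nat.lt_of_succ_lt hj'
    have hstep := hh.rotation (.inr (N.sinkEdge ⟨l, hl⟩))
    rw [N.rotation_sinkEdge (j := ⟨l, hl⟩) (j' := ⟨l + 1, hj'⟩) rfl, Sum.swap_inr] at hstep
    have hlt := (hh.lt (N.sinkEdge ⟨l + 1, hj'⟩)).trans_eq hstep
    rcases (Nat.lt_succ_iff.mp hj : (j : ℕ) ≤ l).lt_or_eq with hjl | hjl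
    · exact hlt.trans (ih hl hjl)
    · rwa [show j = ⟨l, hl⟩ from Fin.ext hjl]

end IsHeight

end PerfectPlanarNetwork

/-! ## The bracket at one vertex -/

theorem DoubleBracket.bracket_symm_of_eq_ordSign_smul {k Q α β : Type*} [Field k] [Quiver Q]
    [Fintype Q] [LinearOrder α] [LinearOrder β] {D : DoubleBracket k Q} {x y z w : PathAlgebra k Q}
    {s t : α} {p q : β}
    (hxy : D.bracket x y = (1 / 2 * (ordSign k s t + ordSign k p q)) • (z ⊗ₜ[k] w)) :
    D.bracket y x = (1 / 2 * (ordSign k t s + ordSign k q p)) • (w ⊗ₜ[k] z) := by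
  rw [D.skew, hxy, map_smul, ArrowBracket.swap_tmul, ordSign_swap s t, ordSign_swap p q, ← neg_smul]
  congr 1
  ring

namespace PerfectPlanarNetwork

open PathAlgebra

variable {m n : ℕ} {I E : Type*} [Fintype I] [Fintype E] {N : PerfectPlanarNetwork m n I E}
  {k : Type*} [Field k] {c : LocalWeights k} {h : E ⊕ E → ℚ} {v : I} {e f x y : E}

theorem IsWhite.bracketOn_edge_mul_edge {x₁ x₂ x₃ : E} (hv : N.IsWhite v x₁ x₂ x₃)
    (hN : N.Acyclic) (hW : c.w₁₂ + c.w₁₃ - c.w₂₃ = 1 / 2) (hh : N.IsHeight h)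
    (he : N.tgt e = .inner v) (hf : N.tgt f = .inner v) (hx : N.src x = .inner v)
    (hy : N.src y = .inner v) :
    (N.bracketOn k c {v}).bracket (N.edge k e * N.edge k x) (N.edge k f * N.edge k y) =
      (1 / 2 * (ordSign k (h (.inl f)) (h (.inl e)) + ordSign k (h (.inl y)) (h (.inl x)))) •
        ((N.edge k f * N.edge k x) ⊗ₜ[k] (N.edge k e * N.edge k y)) := by
  obtain rfl := hv.eq_of_tgt he
  obtain rfl := hv.eq_of_tgt hf
  obtain ⟨b₁₂, b₁₃, b₂₃⟩ := hv.vertexBracket (k := k) (c := c) hN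
  rw [← bracketOn_singleton_edge] at b₁₂ b₁₃ b₂₃
  have hself := bracketOn_singleton_edge_self (k := k) (c := c) (v := v) hN
  have hidem : ∀ {x}, N.src x = .inner v → N.innerIdem k v * N.edge k x = N.edge k x :=
    N.idem_mul_edge k _
  have hlt : h (.inl x₁) < h (.inl x₂) := (hh.lt x₁).trans_eq (hh.height_white hv).2.1
  have h₁₂ := DoubleBracket.bracket_mul_mul_of_diverging (hself f) b₁₃ b₂₃ b₁₂ (hidem hv.1)
    (hidem hv.2.1)
  have hcoeff : c.w₁₂ + c.w₁₃ - c.w₂₃ =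
      1 / 2 * (ordSign k (h (.inl f)) (h (.inl f)) + ordSign k (h (.inl x₂)) (h (.inl x₁))) := by
    rw [ordSign_self, ordSign_of_gt hlt, zero_add, mul_one, hW]
  rw [hcoeff] at h₁₂
  rcases hv.eq_or_eq_of_src hx with rfl | rfl <;> rcases hv.eq_or_eq_of_src hy with rfl | rfl
  · rw [DoubleBracket.bracket_mul_self_of_diverging (hself f) (hself _) b₁₃ (hidem hx),
      ordSign_self, ordSign_self, add_zero, mul_zero, zero_smul]
  · exact h₁₂
  · exact DoubleBracket.bracket_symm_of_eq_ordSign_smul h₁₂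
  · rw [DoubleBracket.bracket_mul_self_of_diverging (hself f) (hself _) b₂₃ (hidem hx),
      ordSign_self, ordSign_self, add_zero, mul_zero, zero_smul]

theorem IsBlack.bracketOn_edge_mul_edge {y₁ y₂ y₃ : E} (hv : N.IsBlack v y₁ y₂ y₃)
    (hN : N.Acyclic) (hB : c.b₁₂ + c.b₁₃ - c.b₂₃ = -(1 / 2)) (hh : N.IsHeight h)
    (he : N.tgt e = .inner v) (hf : N.tgt f = .inner v) (hx : N.src x = .inner v)
    (hy : N.src y = .inner v) :
    (N.bracketOn k c {v}).bracket (N.edge k e * N.edge k x) (N.edge k f * N.edge k y) =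
      (1 / 2 * (ordSign k (h (.inl f)) (h (.inl e)) + ordSign k (h (.inl y)) (h (.inl x)))) •
        ((N.edge k f * N.edge k x) ⊗ₜ[k] (N.edge k e * N.edge k y)) := by
  obtain rfl := hv.eq_of_src hx
  obtain rfl := hv.eq_of_src hy
  obtain ⟨b₁₂, b₁₃, b₂₃⟩ := hv.vertexBracket (k := k) (c := c) hN
  rw [← bracketOn_singleton_edge] at b₁₂ b₁₃ b₂₃
  have hself := bracketOn_singleton_edge_self (k := k) (c := c) (v := v) hN
  have hidem : N.innerIdem k v * N.edge k y = N.edge k y := N.idem_mul_edge k y hy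
  have hlt : h (.inl y₂) < h (.inl y₁) := (hh.lt y₂).trans_eq (hh.height_black hv).2.1
  have h₁₂ := DoubleBracket.bracket_mul_mul_of_converging (hself y) b₁₃ b₂₃ b₁₂ hidem
  have hcoeff : c.b₁₂ + c.b₁₃ - c.b₂₃ =
      1 / 2 * (ordSign k (h (.inl y₂)) (h (.inl y₁)) + ordSign k (h (.inl y)) (h (.inl y))) := by
    rw [ordSign_self, ordSign_of_lt hlt, add_zero, mul_neg_one, hB]
  rw [hcoeff] at h₁₂
  rcases hv.eq_or_eq_of_tgt he with rfl | rfl <;> rcases hv.eq_or_eq_of_tgt hf with rfl | rfl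
  · rw [DoubleBracket.bracket_mul_self_of_converging (hself y) (hself _) b₁₃ hidem,
      ordSign_self, ordSign_self, add_zero, mul_zero, zero_smul]
  · exact h₁₂
  · exact DoubleBracket.bracket_symm_of_eq_ordSign_smul h₁₂
  · rw [DoubleBracket.bracket_mul_self_of_converging (hself y) (hself _) b₂₃ hidem,
      ordSign_self, ordSign_self, add_zero, mul_zero, zero_smul]

theorem bracketOn_edge_mul_edge (hN : N.Acyclic) (hW : c.w₁₂ + c.w₁₃ - c.w₂₃ = 1 / 2)
    (hB : c.b₁₂ + c.b₁₃ - c.b₂₃ = -(1 / 2)) (hh : N.IsHeight h) (he : N.tgt e = .inner v)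
    (hf : N.tgt f = .inner v) (hx : N.src x = .inner v) (hy : N.src y = .inner v) :
    (N.bracketOn k c {v}).bracket (N.edge k e * N.edge k x) (N.edge k f * N.edge k y) =
      (1 / 2 * (ordSign k (h (.inl f)) (h (.inl e)) + ordSign k (h (.inl y)) (h (.inl x)))) •
        ((N.edge k f * N.edge k x) ⊗ₜ[k] (N.edge k e * N.edge k y)) := by
  rcases isWhite_or_isBlack (N := N) v with ⟨_, _, _, hv⟩ | ⟨_, _, _, hv⟩
  · exact hv.bracketOn_edge_mul_edge hN hW hh he hf hx hy
  · exact hv.bracketOn_edge_mul_edge hN hB hh he hf hx hy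

end PerfectPlanarNetwork

/-! ## Cuts -/

namespace PerfectPlanarNetwork

open PathAlgebra Algebra.TensorProduct

variable {m n : ℕ} {I E : Type*} [Fintype I] [Fintype E]

section Cuts

variable (N : PerfectPlanarNetwork m n I E)

/-- A set of internal vertices is down-closed if it contains all internal predecessors of its
elements: these are the parts of the network swept so far. -/
def IsDownClosed (S : Finset I) : Prop :=
  ∀ e u v, N.src e = .inner u → N.tgt e = .inner v → v ∈ S → u ∈ S

/-- The edge `e` crosses the cut given by the set `S` of internal vertices: it leads from `S` or a
boundary source to the complement of `S` or a boundary sink. -/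
def IsCut (S : Finset I) (e : E) : Prop :=
  (∀ u, N.src e = .inner u → u ∈ S) ∧ ∀ u, N.tgt e = .inner u → u ∉ S

end Cuts

variable {N : PerfectPlanarNetwork m n I E} {S T : Finset I} {v : I} {e f x y : E}

theorem isDownClosed_empty : N.IsDownClosed ∅ := fun _ _ _ _ _ hw =>
  absurd hw (Finset.notMem_empty _)

theorem IsDownClosed.induction [DecidableEq I] (hN : N.Acyclic)
    {P : ∀ S, N.IsDownClosed S → Prop} (empty : P ∅ isDownClosed_empty)
    (insert : ∀ v S, v ∉ S → ∀ (hS : N.IsDownClosed S) (hvS : N.IsDownClosed (insert v S)),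
      P S hS → P (insert v S) hvS) (S : Finset I) (hS : N.IsDownClosed S) : P S hS := by
  obtain ⟨r, hr⟩ := exists_rank hN
  induction S using Finset.strongInduction with
  | H S ih =>
  rcases S.eq_empty_or_nonempty with rfl | hne
  · exact empty
  obtain ⟨v, hv, hmax⟩ := S.exists_max_image (fun v => r (N.inner v)) hne
  have hdown : N.IsDownClosed (S.erase v) := by
    intro e u w hu hw hwS
    refine Finset.mem_erase.mpr ⟨?_, hS e u w hu hw (Finset.mem_of_mem_erase hwS)⟩
    rintro rfl
    have hlt : r (N.inner u) < r (N.inner w) := by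
      rw [show N.inner u = N.src e from hu.symm, show N.inner w = N.tgt e from hw.symm]
      exact hr e
    exact hlt.not_ge (hmax w (Finset.mem_of_mem_erase hwS))
  have hinsert := insert v _ (Finset.notMem_erase v S) hdown (by rwa [Finset.insert_erase hv])
    (ih _ (Finset.erase_ssubset hv) hdown)
  simpa only [Finset.insert_erase hv] using hinsert

theorem IsCut.eq_sourceEdge (he : N.IsCut ∅ e) : ∃ i, e = N.sourceEdge i := by
  rcases hs : N.src e with i | j | v
  · exact ⟨i, (N.src_eq_source e i).mp hs⟩
  · exact absurd hs (N.src_ne_sink e j)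
  · exact absurd (he.1 v hs) (Finset.notMem_empty v)

theorem isCut_univ_sinkEdge (j : Fin n) : N.IsCut Finset.univ (N.sinkEdge j) := by
  refine ⟨fun u _ => Finset.mem_univ u, fun u hu => ?_⟩
  exact absurd (((N.tgt_eq_sink _ j).mpr rfl).symm.trans hu) (by rintro ⟨⟩)

theorem IsCut.src_eq_or [DecidableEq I] (he : N.IsCut (insert v S) e) :
    N.src e = .inner v ∨ N.IsCut S e ∧ N.tgt e ≠ .inner v := by
  refine or_iff_not_imp_left.mpr fun hsrc => ⟨⟨fun u hu => ?_, fun u hu huS =>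
    he.2 u hu (Finset.mem_insert_of_mem huS)⟩, fun hu => he.2 v hu (Finset.mem_insert_self _ _)⟩
  refine (Finset.mem_insert.mp (he.1 u hu)).resolve_left ?_
  rintro rfl
  exact hsrc hu

theorem isCut_of_tgt [DecidableEq I] (hN : N.Acyclic) (hS : N.IsDownClosed (insert v S))
    (hv : v ∉ S) (he : N.tgt e = .inner v) : N.IsCut S e := by
  refine ⟨fun u hu => ?_, fun u hu => ?_⟩
  · refine (Finset.mem_insert.mp (hS e u v hu he (Finset.mem_insert_self _ _))).resolve_left ?_
    rintro rfl
    exact src_ne_tgt hN e (hu.trans he.symm)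
  · rwa [← NetworkVertex.inner.inj (he.symm.trans hu)]

theorem IsHeight.separated_of_isCut {h : E ⊕ E → ℚ} (hh : N.IsHeight h) (hN : N.Acyclic)
    (hS : N.IsDownClosed S) (he : N.IsCut S e) (hf : N.IsCut S f) (hne : e ≠ f) :
    Separated h e f := by
  classical
  induction S, hS using IsDownClosed.induction hN generalizing e f with
  | empty =>
    obtain ⟨i, rfl⟩ := he.eq_sourceEdge
    obtain ⟨i', rfl⟩ := hf.eq_sourceEdge
    rcases lt_or_gt_of_ne (show i ≠ i' by rintro rfl; exact hne rfl) with hi | hi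
    · exact .inr (hh.height_sourceEdge_le hi)
    · exact .inl (hh.height_sourceEdge_le hi)
  | insert v S hv _ hS ih =>
    have hold : ∀ {f}, N.IsCut S f → N.tgt f ≠ .inner v → ∀ e, N.tgt e = .inner v →
        Separated h e f := fun hf hfv e he =>
      ih (isCut_of_tgt hN hS hv he) hf (by rintro rfl; exact hfv he)
    rcases he.src_eq_or with hev | ⟨he, hev⟩ <;> rcases hf.src_eq_or with hfv | ⟨hf, hfv⟩
    · exact hh.separated_of_src hev hfv hne
    · exact hh.separated_of_separated_incoming hev (hold hf hfv)
    · exact (hh.separated_of_separated_incoming hfv (hold he hev)).symm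
    · exact ih he hf hne

/-! ## The bracket across a cut -/

section Casimir

variable {k : Type*} [Field k] {c : LocalWeights k}

theorem isCasimir_pathSum (hN : N.Acyclic) (hS : N.IsDownClosed S) (hST : Disjoint S T)
    (i : Fin m) {b : N.Vertex} (hinner : ∀ u, b = .inner u → u ∈ S) (hsink : ∀ j, b ≠ .sink j) :
    (N.bracketOn k c T).IsCasimir (N.pathSum k i b) := by
  have of_path : ∀ p : Quiver.Path (N.source i) b,
      (N.bracketOn k c T).IsCasimir (ofPath k p) := by
    intro p
    induction p with
    | nil => exact DoubleBracket.isCasimir_idem _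
    | @cons a b p g ih =>
      have ha : ∀ u, a = .inner u → u ∈ S := by
        intro u hu
        rcases hb : N.tgt g.1 with i' | j | w
        · exact absurd hb (N.tgt_ne_source g.1 i')
        · exact absurd (g.2.2.symm.trans hb) (hsink j)
        · exact hS g.1 u w (g.2.1.trans hu) hb (hinner w (g.2.2.symm.trans hb))
      rw [ofPath_cons_eq_mul_edge]
      refine (ih ha fun j hj => N.src_ne_sink g.1 j (g.2.1.trans hj)).mul
        (isCasimir_edge fun w hw => ⟨fun h => ?_, fun h => ?_⟩)
      · exact Finset.disjoint_left.mp hST (ha w (g.2.1.symm.trans h)) hw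
      · exact Finset.disjoint_left.mp hST (hinner w (g.2.2.symm.trans h)) hw
  have := N.finite_path_of_acyclic hN (N.source i) b
  have := Fintype.ofFinite (Quiver.Path (N.source i) b)
  rw [pathSum, finsum_eq_sum_of_fintype]
  exact DoubleBracket.isCasimir_sum fun p _ => of_path p

theorem isCasimir_pathSum_src (hN : N.Acyclic) (hS : N.IsDownClosed S) (hST : Disjoint S T)
    (i : Fin m) (he : N.IsCut S e) : (N.bracketOn k c T).IsCasimir (N.pathSum k i (N.src e)) :=
  isCasimir_pathSum hN hS hST i he.1 (N.src_ne_sink e)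

theorem isCasimir_edgeSum (hN : N.Acyclic) (hS : N.IsDownClosed S) (hST : Disjoint S T)
    (i : Fin m) (he : N.IsCut S e) (htgt : ∀ w ∈ T, N.tgt e ≠ .inner w) :
    (N.bracketOn k c T).IsCasimir (N.edgeSum k i e) :=
  (isCasimir_pathSum_src hN hS hST i he).mul <| isCasimir_edge fun w hw =>
    ⟨fun h => Finset.disjoint_left.mp hST (he.1 w h) hw, htgt w hw⟩

theorem isCasimir_edge_of_src (hS : N.IsDownClosed S) (hv : v ∉ S) (hx : N.src x = .inner v) :
    (N.bracketOn k c S).IsCasimir (N.edge k x) := by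
  refine isCasimir_edge fun u hu => ⟨fun h => ?_, fun h => hv (hS x v u hx h hu)⟩
  rw [NetworkVertex.inner.inj (hx.symm.trans h)] at hv
  exact hv hu

end Casimir

variable {k : Type*} [Field k] {c : LocalWeights k} {h : E ⊕ E → ℚ}

variable (N k c) in
/-- The bracket of the sums of the paths ending with the edges `e` and `f`, where only the vertices
in `S` contribute, is the one asserted for the boundary measurements, with the order of the heights
of `e` and `f` in place of the order of the sinks. -/
def CutFormula (h : E ⊕ E → ℚ) (S : Finset I) (e f : E) : Prop :=
  ∀ i i' : Fin m, (N.bracketOn k c S).bracket (N.edgeSum k i e) (N.edgeSum k i' f) =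
    (1 / 2 * (ordSign k i i' + ordSign k (h (.inl f)) (h (.inl e)))) •
      (N.edgeSum k i' e ⊗ₜ[k] N.edgeSum k i f)

theorem CutFormula.symm (hef : N.CutFormula k c h S e f) : N.CutFormula k c h S f e :=
  fun i i' => DoubleBracket.bracket_symm_of_eq_ordSign_smul (hef i' i)

theorem cutFormula_empty (hN : N.Acyclic) (hh : N.IsHeight h) (he : N.IsCut ∅ e)
    (hf : N.IsCut ∅ f) : N.CutFormula k c h ∅ e f := by
  intro i i'
  rw [isCasimir_edgeSum hN isDownClosed_empty (Finset.disjoint_empty_left _) i he (by simp)]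
  obtain ⟨a, rfl⟩ := he.eq_sourceEdge
  obtain ⟨b, rfl⟩ := hf.eq_sourceEdge
  by_cases ha : i' = a
  · by_cases hb : i = b
    · rw [ordSign_apply_of_strictAnti hh.strictAnti_height_sourceEdge, ← ha, ← hb,
        ordSign_swap i i', add_neg_cancel, mul_zero, zero_smul]
    · rw [edgeSum_sourceEdge_of_ne hN hb, TensorProduct.tmul_zero, smul_zero]
  · rw [edgeSum_sourceEdge_of_ne hN ha, TensorProduct.zero_tmul, smul_zero]

theorem bracketOn_edgeSum_mul_edge (hS : N.IsDownClosed S) (hv : v ∉ S)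
    (hx : N.src x = .inner v) (hy : N.src y = .inner v)
    (hef : N.CutFormula k c h S e f) (i i' : Fin m) :
    (N.bracketOn k c S).bracket (N.edgeSum k i e * N.edge k x) (N.edgeSum k i' f * N.edge k y) =
      (1 / 2 * (ordSign k i i' + ordSign k (h (.inl f)) (h (.inl e)))) •
        ((N.edgeSum k i' e * N.edge k x) ⊗ₜ[k] (N.edgeSum k i f * N.edge k y)) := by
  rw [(isCasimir_edge_of_src hS hv hx).bracket_mul_mul_right (isCasimir_edge_of_src hS hv hy),
    hef i i', smul_mul_assoc, tmul_mul_tmul]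

section Step

variable (hN : N.Acyclic) (hS : N.IsDownClosed S) (hv : v ∉ S)
include hN hS hv

theorem CutFormula.insert [DecidableEq I] (hf : N.IsCut S f) (hfv : N.tgt f ≠ .inner v)
    (hef : N.CutFormula k c h S e f) : N.CutFormula k c h (insert v S) e f := by
  intro i i'
  have hcas := isCasimir_edgeSum (k := k) (c := c) (T := {v}) hN hS
    (Finset.disjoint_singleton_right.mpr hv) i' hf (by simpa using hfv)
  rw [bracketOn_insert hv, hcas.bracket_right, add_zero, hef i i']

theorem cutFormula_of_outgoing_of_old [DecidableEq I] (hh : N.IsHeight h)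
    (hx : N.src x = .inner v) (hf : N.IsCut S f) (hfv : N.tgt f ≠ .inner v)
    (hsep : ∀ e, N.tgt e = .inner v → Separated h e f)
    (hcut : ∀ e, N.tgt e = .inner v → N.CutFormula k c h S e f) :
    N.CutFormula k c h (insert v S) x f := by
  classical
  refine CutFormula.insert hN hS hv hf hfv fun i i' => ?_
  simp only [edgeSum_eq_sum hN hx, map_sum, LinearMap.sum_apply,
    TensorProduct.sum_tmul, Finset.smul_sum]
  refine Finset.sum_congr rfl fun e he => ?_
  have hev : N.tgt e = .inner v := (Finset.mem_filter.mp he).2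
  rw [(isCasimir_edge_of_src hS hv hx).bracket_mul_left, hcut e hev, smul_mul_assoc, tmul_mul_tmul,
    mul_one, hh.ordSign_outgoing_eq_incoming k hev hx hsep]

theorem bracketOn_singleton_edgeSum_mul_edge (hW : c.w₁₂ + c.w₁₃ - c.w₂₃ = 1 / 2)
    (hB : c.b₁₂ + c.b₁₃ - c.b₂₃ = -(1 / 2)) (hh : N.IsHeight h) (he : N.IsCut S e)
    (hf : N.IsCut S f) (hev : N.tgt e = .inner v) (hfv : N.tgt f = .inner v)
    (hx : N.src x = .inner v) (hy : N.src y = .inner v) (i i' : Fin m) :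
    (N.bracketOn k c {v}).bracket (N.edgeSum k i e * N.edge k x) (N.edgeSum k i' f * N.edge k y) =
      (1 / 2 * (ordSign k (h (.inl f)) (h (.inl e)) + ordSign k (h (.inl y)) (h (.inl x)))) •
        ((N.edgeSum k i' f * N.edge k x) ⊗ₜ[k] (N.edgeSum k i e * N.edge k y)) := by
  have hST : Disjoint S {v} := Finset.disjoint_singleton_right.mpr hv
  simp only [edgeSum, mul_assoc]
  rw [(isCasimir_pathSum_src hN hS hST i he).bracket_mul_mul_left
    (isCasimir_pathSum_src hN hS hST i' hf), bracketOn_edge_mul_edge hN hW hB hh hev hfv hx hy,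
    mul_smul_comm, tmul_mul_tmul]

theorem cutFormula_of_outgoing [DecidableEq I] (hW : c.w₁₂ + c.w₁₃ - c.w₂₃ = 1 / 2)
    (hB : c.b₁₂ + c.b₁₃ - c.b₂₃ = -(1 / 2)) (hh : N.IsHeight h)
    (hx : N.src x = .inner v) (hy : N.src y = .inner v)
    (hcut : ∀ e, N.tgt e = .inner v → N.IsCut S e)
    (hform : ∀ e f, N.tgt e = .inner v → N.tgt f = .inner v → N.CutFormula k c h S e f) :
    N.CutFormula k c h (insert v S) x y := by
  classical
  intro i i'
  let X : Finset E := {e | N.tgt e = .inner v}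
  have mem_X : ∀ {e}, e ∈ X → N.tgt e = .inner v := fun he => (Finset.mem_filter.mp he).2
  let t := fun e f : E =>
    (N.edgeSum k i' e * N.edge k x) ⊗ₜ[k] (N.edgeSum k i f * N.edge k y)
  let s := fun e f : E => ordSign k (h (.inl f)) (h (.inl e))
  have hsum : ∀ {z}, N.src z = .inner v → ∀ i, N.edgeSum k i z =
      ∑ e ∈ X, N.edgeSum k i e * N.edge k z := fun hz i => edgeSum_eq_sum hN hz i
  have hold : (N.bracketOn k c S).bracket (N.edgeSum k i x) (N.edgeSum k i' y) =
      ∑ e ∈ X, ∑ f ∈ X, (1 / 2 * (ordSign k i i' + s e f)) • t e f := by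
    simp only [hsum hx, hsum hy, map_sum, LinearMap.sum_apply]
    rw [Finset.sum_comm]
    refine Finset.sum_congr rfl fun e he => Finset.sum_congr rfl fun f hf => ?_
    exact bracketOn_edgeSum_mul_edge hS hv hx hy (hform e f (mem_X he) (mem_X hf)) i i'
  have hnew : (N.bracketOn k c {v}).bracket (N.edgeSum k i x) (N.edgeSum k i' y) =
      ∑ f ∈ X, ∑ e ∈ X, (1 / 2 * (s e f + s x y)) • t f e := by
    simp only [hsum hx, hsum hy, map_sum, LinearMap.sum_apply]
    refine Finset.sum_congr rfl fun f hf => Finset.sum_congr rfl fun e he => ?_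
    exact bracketOn_singleton_edgeSum_mul_edge hN hS hv hW hB hh (hcut e (mem_X he))
      (hcut f (mem_X hf)) (mem_X he) (mem_X hf) hx hy i i'
  rw [bracketOn_insert hv, hold, hnew, hsum hx, hsum hy, TensorProduct.sum_tmul]
  simp only [TensorProduct.tmul_sum, Finset.smul_sum, ← Finset.sum_add_distrib, ← add_smul]
  refine Finset.sum_congr rfl fun e _ => Finset.sum_congr rfl fun f _ => ?_
  rw [show s f e = -s e f from ordSign_swap _ _]
  congr 1
  ring

end Step

theorem cutFormula_of_isCut (hN : N.Acyclic) (hW : c.w₁₂ + c.w₁₃ - c.w₂₃ = 1 / 2)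
    (hB : c.b₁₂ + c.b₁₃ - c.b₂₃ = -(1 / 2)) (hh : N.IsHeight h) (hS : N.IsDownClosed S)
    (he : N.IsCut S e) (hf : N.IsCut S f) : N.CutFormula k c h S e f := by
  classical
  induction S, hS using IsDownClosed.induction hN generalizing e f with
  | empty => exact cutFormula_empty hN hh he hf
  | insert v S hv hS hvS ih =>
    have hcut : ∀ e, N.tgt e = .inner v → N.IsCut S e := fun e => isCut_of_tgt hN hvS hv
    have hnew_old : ∀ {x f}, N.src x = .inner v → N.IsCut S f → N.tgt f ≠ .inner v →
        N.CutFormula k c h (insert v S) x f := fun hx hf hfv =>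
      cutFormula_of_outgoing_of_old hN hS hv hh hx hf hfv
        (fun e he => hh.separated_of_isCut hN hS (hcut e he) hf (by rintro rfl; exact hfv he))
        fun e he => ih (hcut e he) hf
    rcases he.src_eq_or with hev | ⟨he, hev⟩ <;> rcases hf.src_eq_or with hfv | ⟨hf, hfv⟩
    · exact cutFormula_of_outgoing hN hS hv hW hB hh hev hfv hcut fun e f he hf =>
        ih (hcut e he) (hcut f hf)
    · exact hnew_old hev hf hfv
    · exact (hnew_old hfv he hev).symm
    · exact (ih he hf).insert hN hS hv hf hfv

theorem bracket_boundaryMeasurement (hN : N.Acyclic) (hW : c.w₁₂ + c.w₁₃ - c.w₂₃ = 1 / 2)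
    (hB : c.b₁₂ + c.b₁₃ - c.b₂₃ = -(1 / 2)) (i i' : Fin m) (j j' : Fin n) :
    (N.doubleBracket k c).bracket (N.boundaryMeasurement k i j) (N.boundaryMeasurement k i' j') =
      (1 / 2 * (ordSign k i i' + ordSign k j j')) •
        (N.boundaryMeasurement k i' j ⊗ₜ[k] N.boundaryMeasurement k i j') := by
  obtain ⟨h, hh⟩ := exists_isHeight hN
  have huniv : N.IsDownClosed Finset.univ := fun _ u _ _ _ _ => Finset.mem_univ u
  have hformula := cutFormula_of_isCut (k := k) hN hW hB hh huniv (isCut_univ_sinkEdge j)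
    (isCut_univ_sinkEdge j') i i'
  rw [ordSign_apply_of_strictAnti hh.strictAnti_height_sinkEdge, bracketOn_univ] at hformula
  simpa only [boundaryMeasurement_apply hN] using hformula

end PerfectPlanarNetwork

/-! ## The matrix identity -/

section Matrices

variable {k Q : Type*} [Field k] [Quiver Q] [Fintype Q] {m n : ℕ}

theorem rMatrix_apply (i i' a b : Fin n) : rMatrix k Q n (i, i') (a, b) =
    if a = i' ∧ b = i then algebraMap k _ (1 / 2 * ordSign k i i') else 0 := by
  have hentry : ∀ x y : Fin n, (if x < y then
      Matrix.single y x (1 : k) ⊗ₖ Matrix.single x y (1 : k) -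
        Matrix.single x y (1 : k) ⊗ₖ Matrix.single y x (1 : k) else 0) (i, i') (a, b) =
      (if x = i' then if y = i then if i' < i ∧ a = i' ∧ b = i then 1 else 0 else 0 else 0) -
        if x = i then if y = i' then if i < i' ∧ a = i' ∧ b = i then 1 else 0 else 0 else 0 := by
    intro x y
    rw [apply_ite (fun M : Matrix (Fin n × Fin n) (Fin n × Fin n) k => M (i, i') (a, b))]
    simp only [Matrix.sub_apply, Matrix.kroneckerMap_apply, Matrix.single_apply, Matrix.zero_apply]
    grind
  rw [rMatrix, Matrix.map_apply, Matrix.smul_apply, Matrix.sum_apply]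
  simp only [Matrix.sum_apply, hentry, Finset.sum_sub_distrib, Finset.sum_ite_eq', Finset.mem_univ,
    if_true, Finset.sum_ite_irrel, Finset.sum_const_zero]
  by_cases hab : a = i' ∧ b = i
  · rw [if_pos hab]
    congr 1
    rcases lt_trichotomy i i' with hi | rfl | hi
    · simp [hab, hi, hi.not_gt, ordSign_of_lt hi]
    · simp [ordSign_self]
    · simp [hab, hi, hi.not_gt, ordSign_of_gt hi]
  · simp [hab]

variable (B : Matrix (Fin m) (Fin n) (PathAlgebra k Q)) (i i' : Fin m) (j j' : Fin n)

theorem kronecker_matrixL_matrixR_apply :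
    (matrixL B ⊗ₖ matrixR B) (i, i') (j, j') = B i j ⊗ₜ[k] B i' j' := by
  rw [Matrix.kroneckerMap_apply, matrixL, matrixR, Matrix.map_apply, Matrix.map_apply,
    Algebra.TensorProduct.tmul_mul_tmul, one_mul, mul_one]

theorem rMatrix_mul_kronecker : (rMatrix k Q m * (matrixL B ⊗ₖ matrixR B)) (i, i') (j, j') =
    (1 / 2 * ordSign k i i') • (B i' j ⊗ₜ[k] B i j') := by
  rw [Matrix.mul_apply, Finset.sum_eq_single (i', i)]
  · rw [rMatrix_apply, if_pos ⟨rfl, rfl⟩, ← Algebra.smul_def, kronecker_matrixL_matrixR_apply]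
  · rintro ⟨a, b⟩ - hab
    rw [rMatrix_apply, if_neg fun h => hab (Prod.ext h.1 h.2), zero_mul]
  · exact fun h => absurd (Finset.mem_univ _) h

theorem kronecker_mul_rMatrix : ((matrixL B ⊗ₖ matrixR B) * rMatrix k Q n) (i, i') (j, j') =
    -((1 / 2 * ordSign k j j') • (B i j' ⊗ₜ[k] B i' j)) := by
  rw [Matrix.mul_apply, Finset.sum_eq_single (j', j)]
  · rw [rMatrix_apply, if_pos ⟨rfl, rfl⟩, ← Algebra.commutes, ← Algebra.smul_def,
      kronecker_matrixL_matrixR_apply, ordSign_swap j j', mul_neg, neg_smul]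
  · rintro ⟨a, b⟩ - hab
    rw [rMatrix_apply, if_neg fun h => hab (Prod.ext h.2.symm h.1.symm), mul_zero]
  · exact fun h => absurd (Finset.mem_univ _) h

end Matrices

theorem PerfectPlanarNetwork.matrixBracket_boundaryMeasurement {k : Type*} [Field k]
    {I E : Type*} [Fintype I] [Fintype E] {c : LocalWeights k}
    (hW : c.w₁₂ + c.w₁₃ - c.w₂₃ = 1 / 2) (hB : c.b₁₂ + c.b₁₃ - c.b₂₃ = -(1 / 2))
    {m n : ℕ} {N : PerfectPlanarNetwork m n I E} (hN : N.Acyclic) :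
    (N.doubleBracket k c).matrixBracket (N.boundaryMeasurement k) (N.boundaryMeasurement k) =
      rMatrix k N.Vertex m *
          (matrixL (N.boundaryMeasurement k) ⊗ₖ matrixR (N.boundaryMeasurement k)) -
        matrixSwap
          ((matrixL (N.boundaryMeasurement k) ⊗ₖ matrixR (N.boundaryMeasurement k)) *
            rMatrix k N.Vertex n) := by
  ext ⟨i, i'⟩ ⟨j, j'⟩
  rw [Matrix.sub_apply, matrixSwap, Matrix.map_apply, rMatrix_mul_kronecker,
    kronecker_mul_rMatrix, map_neg, map_smul, ArrowBracket.swap_tmul, sub_neg_eq_add, ← add_smul,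
    ← mul_add]
  exact bracket_boundaryMeasurement hN hW hB i i' j j'

theorem mainTheorem1 {k : Type*} [Field k] (h2 : (2 : k) ≠ 0)
    {I E : Type*} [Fintype I] [Fintype E] (c : LocalWeights k)
    (hW : c.w₁₂ + c.w₁₃ - c.w₂₃ = 1 / 2) (hB : c.b₁₂ + c.b₁₃ - c.b₂₃ = -(1 / 2)) :
    (∀ (m n : ℕ) (N : PerfectPlanarNetwork m n I E), N.Acyclic →
      (N.doubleBracket k c).matrixBracket (N.boundaryMeasurement k) (N.boundaryMeasurement k) =
        rMatrix k N.Vertex m *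
            (matrixL (N.boundaryMeasurement k) ⊗ₖ matrixR (N.boundaryMeasurement k)) -
          matrixSwap
            ((matrixL (N.boundaryMeasurement k) ⊗ₖ matrixR (N.boundaryMeasurement k)) *
              rMatrix k N.Vertex n)) ∧
    (∀ (n : ℕ) (N : PerfectPlanarNetwork n n I E), N.Acyclic →
      (N.doubleBracket k c).matrixBracket (N.boundaryMeasurement k) (N.boundaryMeasurement k) =
        twistedCommutator (rMatrix k N.Vertex n)
          (matrixL (N.boundaryMeasurement k) ⊗ₖ matrixR (N.boundaryMeasurement k))) :=
  ⟨fun _ _ _ hN => PerfectPlanarNetwork.matrixBracket_boundaryMeasurement hW hB hN,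
    fun _ _ hN => PerfectPlanarNetwork.matrixBracket_boundaryMeasurement hW hB hN⟩
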